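/- Let $R$ be an associative ring with unit equipped with an anti-involution $r\mapsto \bar r$, i.e. an additive map with $\overline{\bar r}=r$ and $\overline{rs}=\bar s\,\bar r$. Let $\mathcal{R}_R$ be the discrete bimonoidal category of $R$ (objects the elements of $R$, only identity morphisms, $\oplus$ and $\otimes$ given by addition and multiplication). For $n\ge 0$ let $GL_n(\mathcal{R}_R)$ be the monoidal category of $n\times n$-matrices of objects that are invertible over $R$, with matrix multiplication, and let $BGL_n(\mathcal{R}_R)$ be its bar construction: the simplicial category whose objects in degree $q$ are families of objects $A^{ij}$ ($0\le i<j\le q$) with coherent isomorphisms $\phi^{ijk}\colon A^{ij}\cdot A^{jk}\to A^{ik}$ ($i<j<k$), with the convention that $A^{ii}$ is the unit matrix. Put $\mathcal{K}(\mathcal{R}_R)=\Omega B\bigl(\bigsqcup_{n\ge 0}|BGL_n(\mathcal{R}_R)|\bigr)$, where the topological monoid structure is block sum. Let $\tau$ be the involution on $\mathcal{K}(\mathcal{R}_R)$ induced by $(\tau A)^{ij}=\overline{A^{q-j,q-i}}^{\,t}$, with $\phi^{ijk}$ replaced by $\overline{\phi^{q-k,q-j,q-i}}^{\,t}$, together with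 reversal of the barycentric coordinates of the simplices in the bar direction. Let $K_i(R)=\pi_i\bigl(\Omega B(\bigsqcup_{n\ge 0}|BGL_n(R)|)\bigr)$, $i\ge 1$, be the algebraic $K$-groups of $R$, where $BGL_n(R)$ is the ordinary bar construction of the group $GL_n(R)$, and let the classical involution on $K_i(R)$ be the map induced by the group automorphisms $A\mapsto (\overline{A}^{\,t})^{-1}$ of $GL_n(R)$. Then for every $i\ge 1$ the canonical map $$K_i(R)\longrightarrow \pi_i\,\mathcal{K}(\mathcal{R}_R),$$ induced by sending a simplex $(B_1,\dots,B_q)$ of $BGL_n(R)$ to the object with $A^{ij}=B_{i+1}\cdots B_j$ and all $\phi^{ijk}$ identities, is an isomorphism of groups, and it carries the classical involution on $K_i(R)$ to the involution $\tau_*$ on $\pi_i\,\mathcal{K}(\mathcal{R}_R)$. -/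

import Mathlib

open CategoryTheory Opposite MonoidalCategory

universe u v

namespace BimonoidalK

/-! ### Geometric realisation of presheaves of sets

For a cosimplicial-type functor `Δ : J ⥤ TopCat` and a presheaf of sets `X` on `J`, the realisation
is the usual quotient of `∐ⱼ X j × Δ j`.  It is used for `J` a finite product of copies of the
simplex category and `Δ` the corresponding product of standard topological simplices, where it is
the realisation of a multisimplicial set (equivalently, the realisation iterated one simplicial
direction at a time). -/

section Realization

variable {J : Type} [SmallCategory J]

/-- The disjoint union of the spaces `X j × Δ j`, where `X j` is discrete. -/
abbrev PreRealization (Δ : J ⥤ TopCat.{0}) (X : Jᵒᵖ ⥤ Type u) : Type u :=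
  Σ y : (Σ j : J, X.obj (op j)), Δ.obj y.1

/-- The gluing relation `(f^* x, t) ∼ (x, f_* t)`. -/
inductive RealizationRel (Δ : J ⥤ TopCat.{0}) (X : Jᵒᵖ ⥤ Type u) :
    PreRealization Δ X → PreRealization Δ X → Prop
  | glue {j k : J} (f : j ⟶ k) (x : X.obj (op k)) (t : Δ.obj j) :
      RealizationRel Δ X ⟨⟨j, X.map f.op x⟩, t⟩ ⟨⟨k, x⟩, Δ.map f t⟩

/-- The geometric realisation `|X|`, with the quotient topology. -/
def Realization (Δ : J ⥤ TopCat.{0}) (X : Jᵒᵖ ⥤ Type u) : Type u :=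
  Quot (RealizationRel Δ X)

instance (Δ : J ⥤ TopCat.{0}) (X : Jᵒᵖ ⥤ Type u) : TopologicalSpace (Realization Δ X) :=
  inferInstanceAs (TopologicalSpace (Quot (RealizationRel Δ X)))

/-- The point of `|X|` represented by `x ∈ X j` and `t ∈ Δ j`. -/
def Realization.mk (Δ : J ⥤ TopCat.{0}) (X : Jᵒᵖ ⥤ Type u) (j : J) (x : X.obj (op j))
    (t : Δ.obj j) : Realization Δ X :=
  Quot.mk _ ⟨⟨j, x⟩, t⟩

/-- The map `|X| → |Y|`, `[x, t] ↦ [a x, b t]`, induced by a functor `ρ` between the indexing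
categories and natural maps `a : X j → Y (ρ j)` and `b : Δ j → Δ' (ρ j)`. -/
def Realization.map {J' : Type} [SmallCategory J'] {Δ : J ⥤ TopCat.{0}} {X : Jᵒᵖ ⥤ Type u}
    {Δ' : J' ⥤ TopCat.{0}} {Y : J'ᵒᵖ ⥤ Type u} (ρ : J ⥤ J') (a : X ⟶ ρ.op ⋙ Y)
    (b : Δ ⟶ ρ ⋙ Δ') : C(Realization Δ X, Realization Δ' Y) where
  toFun := Quot.lift (fun z => Realization.mk Δ' Y (ρ.obj z.1.1) (a.app _ z.1.2) (b.app _ z.2)) (by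
    rintro _ _ ⟨f, x, t⟩
    have h1 := ConcreteCategory.congr_hom (a.naturality f.op) x
    have h2 := ConcreteCategory.congr_hom (b.naturality f) t
    dsimp at h1 h2 ⊢
    rw [h1, h2]
    exact Quot.sound (RealizationRel.glue (ρ.map f) _ _))
  continuous_toFun := by
    refine continuous_quot_lift _ ?_
    refine continuous_sigma fun y => ?_
    refine continuous_quot_mk.comp ?_
    exact (continuous_sigmaMk (σ := fun y : (Σ j : J', Y.obj (op j)) => Δ'.obj y.1)
      (i := ⟨ρ.obj y.1, a.app _ y.2⟩)).comp (b.app y.1).hom.continuous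

end Realization

/-! ### The bar construction of a monoid -/

/-- The `q`-simplices of the bar construction of a monoid `M`.  A `q`-simplex
`(g₁, …, g_q) ∈ M^q` is recorded by all its iterated products `a i j = g_{i+1} ⋯ g_j`, `i ≤ j`;
that is, it is a functor from the poset `[q]` to the monoid `M`. -/
@[ext]
structure MonoidBar (M : Type u) [Monoid M] (q : SimplexCategory) where
  a : ∀ i j : Fin (q.len + 1), i ≤ j → M
  a_self : ∀ i, a i i le_rfl = 1
  a_mul : ∀ i j k (hij : i ≤ j) (hjk : j ≤ k), a i j hij * a j k hjk = a i k (hij.trans hjk)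

namespace MonoidBar

variable {M : Type u} [Monoid M] {N : Type v} [Monoid N]

/-- The simplicial structure: precomposition with monotone maps. -/
def pull {p q : SimplexCategory} (θ : q ⟶ p) (x : MonoidBar M p) : MonoidBar M q where
  a i j h := x.a (θ.toOrderHom i) (θ.toOrderHom j) (θ.toOrderHom.monotone h)
  a_self _ := x.a_self _
  a_mul _ _ _ _ _ := x.a_mul _ _ _ _ _

/-- Functoriality in the monoid. -/
def map (f : M →* N) {q : SimplexCategory} (x : MonoidBar M q) : MonoidBar N q where
  a i j h := f (x.a i j h)
  a_self i := by rw [x.a_self, map_one]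
  a_mul i j k hij hjk := by rw [← map_mul, x.a_mul]

instance (q : SimplexCategory) : One (MonoidBar M q) :=
  ⟨⟨fun _ _ _ => 1, fun _ => rfl, fun _ _ _ _ _ => one_mul 1⟩⟩

end MonoidBar

section ClassifyingSpace

variable {J : Type} [SmallCategory J]

/-- `(p, j) ↦ Δ^p × Δ j`. -/
noncomputable def simplexProd (Δ : J ⥤ TopCat.{0}) : SimplexCategory × J ⥤ TopCat.{0} where
  obj x := TopCat.of (SimplexCategory.toTop₀.obj x.1 × Δ.obj x.2)
  map f := TopCat.ofHom
    ((SimplexCategory.toTop₀.map f.1).hom.prodMap (Δ.map f.2).hom)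
  map_id x := by
    ext y
    · exact ConcreteCategory.congr_hom (SimplexCategory.toTop₀.map_id x.1) y.1
    · exact ConcreteCategory.congr_hom (Δ.map_id x.2) y.2
  map_comp f g := by
    ext y
    · exact ConcreteCategory.congr_hom (SimplexCategory.toTop₀.map_comp f.1 g.1) y.1
    · exact ConcreteCategory.congr_hom (Δ.map_comp f.2 g.2) y.2

/-- The bar construction applied degreewise: `(p, j) ↦ B_p (M j)`, which is `(M j)^p`. -/
def degreewiseBar (M : Jᵒᵖ ⥤ MonCat.{u}) : (SimplexCategory × J)ᵒᵖ ⥤ Type u where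
  obj x := MonoidBar (M.obj (op x.unop.2)) x.unop.1
  map f := ↾fun x => (x.map (M.map f.unop.2.op).hom).pull f.unop.1
  map_id x := by
    ext y i j h
    exact ConcreteCategory.congr_hom (M.map_id (op x.unop.2)) (y.a i j h)
  map_comp {x₁ x₂ x₃} f g := by
    ext y i j h
    exact ConcreteCategory.congr_hom (M.map_comp f.unop.2.op g.unop.2.op) _

/-- The classifying space `B|M|` of the monoid `|M|`, for a (multi)simplicial monoid `M`: the
realisation of the degreewise bar construction. -/
noncomputable def ClassifyingSpace (Δ : J ⥤ TopCat.{0}) (M : Jᵒᵖ ⥤ MonCat.{u}) : Type u :=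
  Realization (simplexProd Δ) (degreewiseBar M)

instance (Δ : J ⥤ TopCat.{0}) (M : Jᵒᵖ ⥤ MonCat.{u}) :
    TopologicalSpace (ClassifyingSpace Δ M) :=
  inferInstanceAs (TopologicalSpace (Realization (simplexProd Δ) (degreewiseBar M)))

/-- The vertex of `B|M|`, written with an auxiliary point `t` of `Δ j`. -/
noncomputable def ClassifyingSpace.base (Δ : J ⥤ TopCat.{0}) (M : Jᵒᵖ ⥤ MonCat.{u}) (j : J) (t : Δ.obj j) :
    ClassifyingSpace Δ M :=
  Realization.mk (simplexProd Δ) (degreewiseBar M) (SimplexCategory.mk 0, j)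
    (1 : MonoidBar (M.obj (op j)) (SimplexCategory.mk 0)) (default, t)

/-- Maps of classifying spaces induced by homomorphisms `a` of (multi)simplicial monoids. -/
noncomputable def ClassifyingSpace.map {J' : Type} [SmallCategory J'] {Δ : J ⥤ TopCat.{0}}
    {M : Jᵒᵖ ⥤ MonCat.{u}} {Δ' : J' ⥤ TopCat.{0}} {N : J'ᵒᵖ ⥤ MonCat.{u}} (ρ : J ⥤ J')
    (a : M ⟶ ρ.op ⋙ N) (b : Δ ⟶ ρ ⋙ Δ') :
    C(ClassifyingSpace Δ M, ClassifyingSpace Δ' N) :=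
  Realization.map (Δ := simplexProd Δ) (X := degreewiseBar M) (Δ' := simplexProd Δ')
    (Y := degreewiseBar N) (Functor.prod (𝟭 SimplexCategory) ρ)
    { app := fun x => ↾fun y => MonoidBar.map (a.app (op x.unop.2)).hom y
      naturality := fun x x' f => by
        ext y
        refine MonoidBar.ext (funext fun i => funext fun j => funext fun h => ?_)
        exact ConcreteCategory.congr_hom (a.naturality f.unop.2.op) _ }
    { app := fun x => TopCat.ofHom ((ContinuousMap.id _).prodMap (b.app x.2).hom)
      naturality := fun x x' f => by
        ext y
        apply Prod.ext
        · rfl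
        · exact ConcreteCategory.congr_hom (b.naturality f.2) y.2 }

lemma ClassifyingSpace.map_base {J' : Type} [SmallCategory J'] {Δ : J ⥤ TopCat.{0}}
    {M : Jᵒᵖ ⥤ MonCat.{u}} {Δ' : J' ⥤ TopCat.{0}} {N : J'ᵒᵖ ⥤ MonCat.{u}} (ρ : J ⥤ J')
    (a : M ⟶ ρ.op ⋙ N) (b : Δ ⟶ ρ ⋙ Δ') (j : J) (t : Δ.obj j) :
    ClassifyingSpace.map ρ a b (ClassifyingSpace.base Δ M j t) =
      ClassifyingSpace.base Δ' N (ρ.obj j) (b.app j t) := by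
  have h : MonoidBar.map (a.app (op j)).hom (1 : MonoidBar (M.obj (op j)) (SimplexCategory.mk 0)) =
      (1 : MonoidBar (N.obj (op (ρ.obj j))) (SimplexCategory.mk 0)) := by
    apply MonoidBar.ext
    funext _ _ _
    exact map_one _
  change Realization.mk (simplexProd Δ') (degreewiseBar N) (SimplexCategory.mk 0, ρ.obj j)
    (MonoidBar.map (a.app (op j)).hom (1 : MonoidBar (M.obj (op j)) (SimplexCategory.mk 0)))
    (default, b.app j t) = _
  rw [h]
  rfl

end ClassifyingSpace

/-! ### Induced maps on loop spaces and homotopy groups -/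

section Homotopy

open scoped Topology Topology.Homotopy

variable {X Y : Type u} [TopologicalSpace X] [TopologicalSpace Y]

/-- The map `Ω(X, x) → Ω(Y, y)` induced by a pointed map. -/
def loopMap (f : C(X, Y)) {x : X} {y : Y} (h : f x = y) :
    C(LoopSpace X x, LoopSpace Y y) where
  toFun γ := (γ.map f.continuous).cast h.symm h.symm
  continuous_toFun := by
    refine continuous_induced_rng.2 ?_
    exact (ContinuousMap.continuous_postcomp f).comp continuous_induced_dom

/-- The map `π_N(X, x) → π_N(Y, y)` induced by a pointed map. -/
def homotopyGroupMap (N : Type) (f : C(X, Y)) {x : X} {y : Y} (h : f x = y) :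
    HomotopyGroup N X x → HomotopyGroup N Y y :=
  Quotient.map (fun γ => ⟨f.comp γ.1, fun t ht => by
    rw [ContinuousMap.comp_apply, ← h]; exact congrArg f (γ.2 t ht)⟩)
    (fun _ _ H => ContinuousMap.HomotopicRel.comp_continuousMap H f)

/-- The base point of a loop space is the constant loop. -/
lemma loopMap_refl (f : C(X, Y)) {x : X} {y : Y} (h : f x = y) :
    loopMap f h (Path.refl x) = Path.refl y := by
  subst h
  rfl

end Homotopy

/-! ### Matrices and block sums -/

section Matrices

/-- The block sum `A ⊕ B` of two square matrices. -/
def blockSum {R : Type u} [Ring R] {n m : ℕ} (A : Matrix (Fin n) (Fin n) R)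
    (B : Matrix (Fin m) (Fin m) R) : Matrix (Fin (n + m)) (Fin (n + m)) R :=
  Matrix.reindex finSumFinEquiv finSumFinEquiv (Matrix.fromBlocks A 0 0 B)

/-- Block sum as a homomorphism for matrix multiplication. -/
def blockSumHom (R : Type u) [Ring R] (n m : ℕ) : Matrix (Fin n) (Fin n) R × Matrix (Fin m) (Fin m) R →*
    Matrix (Fin (n + m)) (Fin (n + m)) R where
  toFun x := blockSum x.1 x.2
  map_one' := by
    simp [blockSum, Matrix.fromBlocks_one]
  map_mul' x y := by
    simp [blockSum, Matrix.submatrix_mul_equiv, Matrix.fromBlocks_multiply]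

/-- The set `∐ₙ Mₙ(R)` of square matrices of arbitrary size. -/
def SqMat (R : Type u) : Type u := Σ n : ℕ, Matrix (Fin n) (Fin n) R

lemma SqMat.ext {R : Type u} {x y : SqMat R} (h : x.1 = y.1)
    (h' : ∀ i j, x.2 i j = y.2 (Fin.cast h i) (Fin.cast h j)) : x = y := by
  obtain ⟨n, A⟩ := x
  obtain ⟨m, B⟩ := y
  obtain rfl : n = m := h
  exact congrArg (Sigma.mk n) (Matrix.ext h')

lemma blockSum_apply {R : Type u} [Ring R] {n m : ℕ} (A : Matrix (Fin n) (Fin n) R) (B : Matrix (Fin m) (Fin m) R)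
    (i j : Fin (n + m)) : blockSum A B i j =
      if hi : i.1 < n then (if hj : j.1 < n then A ⟨i, hi⟩ ⟨j, hj⟩ else 0)
      else (if hj : j.1 < n then 0 else B ⟨i - n, by omega⟩ ⟨j - n, by omega⟩) := by
  induction i using Fin.addCases <;> induction j using Fin.addCases <;>
    simp [blockSum]

/-- Square matrices of arbitrary size form a monoid under block sum (written multiplicatively),
with the empty matrix as neutral element. -/
instance (R : Type u) [Ring R] : Monoid (SqMat R) where
  mul x y := ⟨x.1 + y.1, blockSum x.2 y.2⟩
  one := ⟨0, 1⟩
  mul_assoc x y z := by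
    refine SqMat.ext (add_assoc _ _ _) fun i j => ?_
    change blockSum (blockSum x.2 y.2) z.2 i j = blockSum x.2 (blockSum y.2 z.2) _ _
    simp only [blockSum_apply, Fin.val_cast]
    split_ifs <;> first | rfl | omega | simp only [Nat.sub_sub]
  one_mul x := by
    refine SqMat.ext (zero_add _) fun i j => ?_
    change blockSum 1 x.2 i j = _
    simp [blockSum_apply]
    rfl
  mul_one x := by
    refine SqMat.ext (add_zero _) fun i j => ?_
    change blockSum x.2 1 i j = _
    have hi : i.1 < x.1 := i.2
    have hj : j.1 < x.1 := j.2
    simp only [blockSum_apply, hi, hj, dif_pos]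
    rfl

end Matrices

/-! ### The K-theory of a ring and its classical involution -/

section ClassicalK

/-- The group `GLₙ(R)`. -/
abbrev GL' (R : Type u) [Ring R] (n : ℕ) : Type u := (Matrix (Fin n) (Fin n) R)ˣ

/-- Block sum `GLₙ(R) × GLₘ(R) → GLₙ₊ₘ(R)`. -/
def glBlockSum (R : Type u) [Ring R] (n m : ℕ) : GL' R n × GL' R m →* GL' R (n + m) :=
  (Units.map (blockSumHom R n m)).comp MulEquiv.prodUnits.symm.toMonoidHom

/-- The `q`-simplices of the simplicial monoid `∐ₙ BGLₙ(R)`. -/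
def GLBar (R : Type u) [Ring R] (q : SimplexCategory) : Type u := Σ n : ℕ, MonoidBar (GL' R n) q

variable {R : Type u} [Ring R]

/-- The matrices of which a simplex of `∐ₙ BGLₙ(R)` consists. -/
def GLBar.entry {q : SimplexCategory} (x : GLBar R q) (i j : Fin (q.len + 1)) (h : i ≤ j) :
    SqMat R := ⟨x.1, (x.2.a i j h : Matrix (Fin x.1) (Fin x.1) R)⟩

lemma GLBar.ext {q : SimplexCategory} {x y : GLBar R q}
    (H : ∀ i j h, x.entry i j h = y.entry i j h) : x = y := by
  obtain ⟨n, x⟩ := x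
  obtain ⟨m, y⟩ := y
  obtain rfl : n = m := congrArg Sigma.fst (H 0 0 le_rfl)
  refine congrArg (Sigma.mk n) (MonoidBar.ext ?_)
  funext i j h
  exact Units.ext (eq_of_heq (Sigma.mk.inj (H i j h)).2)

/-- `∐ₙ BGLₙ(R)` is a monoid under block sum in each simplicial degree. -/
instance (q : SimplexCategory) : Monoid (GLBar R q) where
  mul x y := ⟨x.1 + y.1,
    { a := fun i j h => glBlockSum R x.1 y.1 (x.2.a i j h, y.2.a i j h)
      a_self := fun i => by rw [x.2.a_self, y.2.a_self]; exact map_one _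
      a_mul := fun i j k hij hjk => by
        rw [← map_mul, Prod.mk_mul_mk, x.2.a_mul, y.2.a_mul] }⟩
  one := ⟨0, 1⟩
  mul_assoc x y z := GLBar.ext fun i j h =>
    mul_assoc (x.entry i j h) (y.entry i j h) (z.entry i j h)
  one_mul x := GLBar.ext fun i j h => one_mul (x.entry i j h)
  mul_one x := GLBar.ext fun i j h => mul_one (x.entry i j h)

/-- The simplicial monoid `∐ₙ BGLₙ(R)`. -/
def glBar (R : Type u) [Ring R] : SimplexCategoryᵒᵖ ⥤ MonCat.{u} where
  obj q := MonCat.of (GLBar R q.unop)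
  map θ := MonCat.ofHom
    { toFun := fun x => ⟨x.1, x.2.pull θ.unop⟩
      map_one' := rfl
      map_mul' := fun _ _ => rfl }

/-- The standard topological simplices `q ↦ Δ^q`. -/
noncomputable abbrev simplexTop : SimplexCategory ⥤ TopCat.{0} := SimplexCategory.toTop₀

/-- The space `B(∐ₙ |BGLₙ(R)|)`. -/
abbrev RingBM (R : Type u) [Ring R] : Type u := ClassifyingSpace simplexTop (glBar R)

/-- The base point of `B(∐ₙ |BGLₙ(R)|)`. -/
noncomputable def ringBase (R : Type u) [Ring R] : RingBM R :=
  ClassifyingSpace.base simplexTop (glBar R) (SimplexCategory.mk 0)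
    (default : SimplexCategory.toTop₀.obj (SimplexCategory.mk 0))

/-- The (free) algebraic K-theory space `K(R) = ΩB(∐ₙ |BGLₙ(R)|)` of the ring `R`. -/
abbrev RingKSpace (R : Type u) [Ring R] : Type u := LoopSpace (RingBM R) (ringBase R)

/-- The K-group `K_i(R) = π_i(ΩB(∐ₙ |BGLₙ(R)|))`, `i ≥ 1`. -/
abbrev RingK (R : Type u) [Ring R] (i : ℕ) : Type u :=
  HomotopyGroup.Pi i (RingKSpace R) (Path.refl (ringBase R))

/-- The automorphism of the group `GLₙ(R)` sending `A` to the inverse of the transpose of the matrix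
obtained from `A` by applying the anti-involution to its entries. -/
def conjTransposeInv (R : Type u) [Ring R] [StarRing R] (n : ℕ) : GL' R n →* GL' R n where
  toFun A :=
    { val := (A⁻¹).val.conjTranspose
      inv := A.val.conjTranspose
      val_inv := by rw [← Matrix.conjTranspose_mul, A.mul_inv, Matrix.conjTranspose_one]
      inv_val := by rw [← Matrix.conjTranspose_mul, A.inv_mul, Matrix.conjTranspose_one] }
  map_one' := Units.ext (by simp)
  map_mul' A B := Units.ext (by simp)

lemma conjTranspose_blockSum {R : Type u} [Ring R] [StarRing R] {n m : ℕ}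
    (A : Matrix (Fin n) (Fin n) R) (B : Matrix (Fin m) (Fin m) R) :
    (blockSum A B).conjTranspose = blockSum A.conjTranspose B.conjTranspose := by
  simp [blockSum, Matrix.fromBlocks_conjTranspose]

/-- The endomorphism of the simplicial monoid `∐ₙ BGLₙ(R)` induced by the group automorphisms
`conjTransposeInv`. -/
def glBarInv (R : Type u) [Ring R] [StarRing R] : glBar R ⟶ (𝟭 SimplexCategory).op ⋙ glBar R where
  app q := MonCat.ofHom
    { toFun := fun x => (⟨x.1, x.2.map (conjTransposeInv R x.1)⟩ : GLBar R q.unop)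
      map_one' := GLBar.ext fun _ _ _ => congrArg (Sigma.mk 0) (Subsingleton.elim _ _)
      map_mul' := fun x y => GLBar.ext fun _ _ _ =>
        congrArg (Sigma.mk (x.1 + y.1)) (conjTranspose_blockSum _ _) }
  naturality _ _ _ := rfl

/-- The classical involution on `B(∐ₙ |BGLₙ(R)|)`. -/
noncomputable def classicalInvBM (R : Type u) [Ring R] [StarRing R] : C(RingBM R, RingBM R) :=
  ClassifyingSpace.map (𝟭 SimplexCategory) (glBarInv R) (Functor.leftUnitor simplexTop).inv

lemma classicalInvBM_base (R : Type u) [Ring R] [StarRing R] :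
    classicalInvBM R (ringBase R) = ringBase R :=
  ClassifyingSpace.map_base _ _ _ _ _

/-- The classical involution on `K(R)`. -/
noncomputable def classicalInvSpace (R : Type u) [Ring R] [StarRing R] :
    C(RingKSpace R, RingKSpace R) :=
  loopMap (classicalInvBM R) (classicalInvBM_base R)

/-- The classical involution on `K_i(R)`. -/
noncomputable def classicalInv (R : Type u) [Ring R] [StarRing R] (i : ℕ) :
    RingK R i → RingK R i :=
  homotopyGroupMap (Fin i) (classicalInvSpace R) (loopMap_refl _ _)

end ClassicalK

/-! ### The bar construction of a monoidal category -/

section BarConstruction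

/-- An object of `B_q(C)` for a monoidal category `C`: objects `A^{ij}` and coherent isomorphisms
`φ^{ijk} : A^{ij} ⊗ A^{jk} ≅ A^{ik}`, for `i < j < k`.  The convention that the `A^{ii}` are
the unit object (and that the `φ^{iij}`, `φ^{ijj}` are the unit isomorphisms) is built in. -/
structure BarObj (C : Type u) [Category.{v} C] [MonoidalCategory C] (q : SimplexCategory) where
  obj : ∀ i j : Fin (q.len + 1), i ≤ j → C
  obj_self : ∀ i, obj i i le_rfl = 𝟙_ C
  φ : ∀ i j k (hij : i ≤ j) (hjk : j ≤ k), obj i j hij ⊗ obj j k hjk ≅ obj i k (hij.trans hjk)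
  coherence : ∀ i j k l (hij : i ≤ j) (hjk : j ≤ k) (hkl : k ≤ l),
    (φ i j k hij hjk).hom ▷ obj k l hkl ≫ (φ i k l (hij.trans hjk) hkl).hom =
      (α_ (obj i j hij) (obj j k hjk) (obj k l hkl)).hom ≫
        obj i j hij ◁ (φ j k l hjk hkl).hom ≫ (φ i j l hij (hjk.trans hkl)).hom
  φ_left : ∀ i j (h : i ≤ j), (φ i i j le_rfl h).hom =
    eqToHom (obj_self i) ▷ obj i j h ≫ (λ_ (obj i j h)).hom
  φ_right : ∀ i j (h : i ≤ j), (φ i j j h le_rfl).hom =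
    obj i j h ◁ eqToHom (obj_self j) ≫ (ρ_ (obj i j h)).hom

namespace BarObj

variable {C : Type u} [Category.{v} C] [MonoidalCategory C] {q : SimplexCategory}

/-- A morphism in `B_q(C)`: morphisms `f^{ij} : A^{ij} ⟶ B^{ij}` compatible with the structure
isomorphisms (with `f^{ii}` the identity of the unit object). -/
@[ext]
structure Hom (A B : BarObj C q) where
  f : ∀ i j (h : i ≤ j), A.obj i j h ⟶ B.obj i j h
  f_self : ∀ i, f i i le_rfl = eqToHom ((A.obj_self i).trans (B.obj_self i).symm)
  comm : ∀ i j k (hij : i ≤ j) (hjk : j ≤ k),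
    (A.φ i j k hij hjk).hom ≫ f i k (hij.trans hjk) =
      (f i j hij ⊗ₘ f j k hjk) ≫ (B.φ i j k hij hjk).hom

instance : Category.{v} (BarObj C q) where
  Hom := Hom
  id A := { f := fun _ _ _ => 𝟙 _, f_self := by simp, comm := by simp }
  comp F G :=
    { f := fun i j h => F.f i j h ≫ G.f i j h
      f_self := fun i => by rw [F.f_self, G.f_self, eqToHom_trans]
      comm := fun i j k hij hjk => by
        rw [← Category.assoc, F.comm, Category.assoc, G.comm, ← Category.assoc,
          ← MonoidalCategory.tensorHom_comp_tensorHom] }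
  id_comp F := Hom.ext (by funext i j h; exact Category.id_comp _)
  comp_id F := Hom.ext (by funext i j h; exact Category.comp_id _)
  assoc F G H := Hom.ext (by funext i j h; exact Category.assoc _ _ _)

/-- The simplicial structure: precomposition with monotone maps. -/
def pull {p q : SimplexCategory} (θ : q ⟶ p) : BarObj C p ⥤ BarObj C q where
  obj A :=
    { obj := fun i j h =>
        A.obj (θ.toOrderHom i) (θ.toOrderHom j) (θ.toOrderHom.monotone h)
      obj_self := fun _ => A.obj_self _
      φ := fun _ _ _ _ _ => A.φ _ _ _ _ _
      coherence := fun _ _ _ _ _ _ _ => A.coherence _ _ _ _ _ _ _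
      φ_left := fun _ _ _ => A.φ_left _ _ _
      φ_right := fun _ _ _ => A.φ_right _ _ _ }
  map F :=
    { f := fun i j h => F.f (θ.toOrderHom i) (θ.toOrderHom j) (θ.toOrderHom.monotone h)
      f_self := fun _ => F.f_self _
      comm := fun _ _ _ _ _ => F.comm _ _ _ _ _ }
  map_id _ := rfl
  map_comp _ _ := rfl

/-- If `C` has at most one morphism between any two objects, then so does `B_q(C)`. -/
instance [Quiver.IsThin C] : Quiver.IsThin (BarObj C q) := fun _ _ =>
  ⟨fun F G => Hom.ext (by funext i j h; exact Subsingleton.elim _ _)⟩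

end BarObj

/-- The simplicial category `B(C)`. -/
def barConstruction (C : Type u) [Category.{v} C] [MonoidalCategory C] :
    SimplexCategoryᵒᵖ ⥤ Cat.{v, max u v} where
  obj q := Cat.of (BarObj C q.unop)
  map θ := (BarObj.pull θ.unop).toCatHom
  map_id _ := rfl
  map_comp _ _ := rfl

end BarConstruction

/-! ### Matrices over the discrete bimonoidal category of a ring -/

section MatrixCategories

/-- The discrete bimonoidal category `𝓡_R` of a ring `R`: its objects are the elements of `R`,
it has only identity morphisms, and `⊕`, `⊗` are the addition and multiplication of `R`.  All of
its structure isomorphisms are identities. -/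
abbrev RCat (R : Type u) : Type u := Discrete R

/-- The iterated sum `⨁_k A_k` in `𝓡_R`. -/
def RCat.bigSum {R : Type u} [Ring R] {n : ℕ} (A : Fin n → RCat R) : RCat R :=
  ⟨∑ k, (A k).as⟩

/-- The product `A ⊗ B` in `𝓡_R`. -/
def RCat.mul {R : Type u} [Ring R] (A B : RCat R) : RCat R := ⟨A.as * B.as⟩

/-- The anti-involution functor `ζ` on `𝓡_R`; the isomorphisms
`μ : ζ (A ⊗ B) ≅ ζ B ⊗ ζ A` are identities. -/
def RCat.zeta (R : Type u) [Ring R] [StarRing R] : RCat R ⥤ RCat R :=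
  Discrete.functor fun r => ⟨star r⟩

/-- The category `Mₙ(C)`: objects are matrices of objects, morphisms are matrices of morphisms. -/
def MatCat (C : Type u) (n : ℕ) : Type u := Fin n → Fin n → C

instance (C : Type u) [Category.{v} C] (n : ℕ) : Category.{v} (MatCat C n) :=
  inferInstanceAs (Category.{v} (Fin n → Fin n → C))

variable {R : Type u} {n : ℕ}

instance : Quiver.IsThin (MatCat (RCat R) n) := fun A B =>
  ⟨fun f g => funext fun i => funext fun j =>
    Subsingleton.elim (α := (A i j : RCat R) ⟶ B i j) (f i j) (g i j)⟩

/-- The matrix over `R` formed by an object of `Mₙ(𝓡_R)`. -/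
def MatCat.toMatrix (A : MatCat (RCat R) n) : Matrix (Fin n) (Fin n) R :=
  Matrix.of fun i j => (A i j).as

/-- The object of `Mₙ(𝓡_R)` formed by a matrix over `R`. -/
def MatCat.ofMatrix (A : Matrix (Fin n) (Fin n) R) : MatCat (RCat R) n := fun i j => ⟨A i j⟩

lemma MatCat.eq_of_hom {A B : MatCat (RCat R) n} (f : A ⟶ B) : A = B := by
  funext i j
  exact Discrete.ext (Discrete.eq_of_hom (f i j))

lemma MatCat.toMatrix_injective {A B : MatCat (RCat R) n} (h : A.toMatrix = B.toMatrix) :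
    A = B := by
  funext i j
  exact Discrete.ext (congrFun (congrFun h i) j)

variable [Ring R]

/-- The matrix product `(A · B)_{ij} = ⨁_k A_{ik} ⊗ B_{kj}` of objects of `Mₙ(𝓡_R)`. -/
def MatCat.mul (A B : MatCat (RCat R) n) : MatCat (RCat R) n := fun i j =>
  RCat.bigSum fun k => RCat.mul (A i k) (B k j)

/-- The unit matrix object `Eₙ`. -/
def MatCat.one : MatCat (RCat R) n := fun i j => ⟨if i = j then 1 else 0⟩

lemma MatCat.toMatrix_mul (A B : MatCat (RCat R) n) :
    (MatCat.mul A B).toMatrix = A.toMatrix * B.toMatrix := by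
  ext i j
  simp [MatCat.mul, MatCat.toMatrix, RCat.bigSum, RCat.mul, Matrix.mul_apply]

lemma MatCat.toMatrix_one : (MatCat.one : MatCat (RCat R) n).toMatrix = 1 := by
  ext i j
  simp [MatCat.one, MatCat.toMatrix, Matrix.one_apply]

/-- The monoidal structure of `Mₙ(𝓡_R)` given by matrix multiplication. -/
instance : MonoidalCategory (MatCat (RCat R) n) where
  tensorObj := MatCat.mul
  tensorUnit := MatCat.one
  whiskerLeft X _ _ f := eqToHom (by rw [MatCat.eq_of_hom f])
  whiskerRight f X := eqToHom (by rw [MatCat.eq_of_hom f])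
  tensorHom f g := eqToHom (by rw [MatCat.eq_of_hom f, MatCat.eq_of_hom g])
  leftUnitor X := eqToIso (MatCat.toMatrix_injective (by
    rw [MatCat.toMatrix_mul, MatCat.toMatrix_one, one_mul]))
  rightUnitor X := eqToIso (MatCat.toMatrix_injective (by
    rw [MatCat.toMatrix_mul, MatCat.toMatrix_one, mul_one]))
  associator X Y Z := eqToIso (MatCat.toMatrix_injective (by
    simp only [MatCat.toMatrix_mul, mul_assoc]))
  tensorHom_def _ _ := Subsingleton.elim _ _
  id_tensorHom_id _ _ := Subsingleton.elim _ _
  tensorHom_comp_tensorHom _ _ _ _ := Subsingleton.elim _ _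
  whiskerLeft_id _ _ := Subsingleton.elim _ _
  id_whiskerRight _ _ := Subsingleton.elim _ _
  associator_naturality _ _ _ := Subsingleton.elim _ _
  leftUnitor_naturality _ := Subsingleton.elim _ _
  rightUnitor_naturality _ := Subsingleton.elim _ _
  pentagon _ _ _ _ := Subsingleton.elim _ _
  triangle _ _ := Subsingleton.elim _ _

/-- The weakly invertible matrices: those whose matrix of `π₀`-classes is invertible over the group
completion of `π₀(𝓡_R)`.  Here `π₀(𝓡_R) = R`, which is its own group completion. -/
def weaklyInvertible (R : Type u) [Ring R] (n : ℕ) : ObjectProperty (MatCat (RCat R) n) :=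
  fun A => IsUnit A.toMatrix

instance (R : Type u) [Ring R] (n : ℕ) : (weaklyInvertible R n).IsMonoidal where
  prop_unit := by
    change IsUnit (MatCat.one : MatCat (RCat R) n).toMatrix
    rw [MatCat.toMatrix_one]
    exact isUnit_one
  prop_tensor A B hA hB := by
    change IsUnit (MatCat.mul A B).toMatrix
    rw [MatCat.toMatrix_mul]
    exact IsUnit.mul hA hB

/-- The monoidal category `GLₙ(𝓡_R)` of weakly invertible matrices, a full monoidal subcategory of
`Mₙ(𝓡_R)`. -/
abbrev GLCat (R : Type u) [Ring R] (n : ℕ) : Type u := (weaklyInvertible R n).FullSubcategory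

instance : Quiver.IsThin (GLCat R n) := fun A B =>
  ⟨fun _ _ => ObjectProperty.hom_ext _ (Subsingleton.elim (α := (A.obj ⟶ B.obj)) _ _)⟩

lemma GLCat.ext {A B : GLCat R n} (h : A.obj.toMatrix = B.obj.toMatrix) : A = B :=
  ObjectProperty.FullSubcategory.ext (MatCat.toMatrix_injective h)

lemma GLCat.toMatrix_tensor (A B : GLCat R n) :
    (A ⊗ B).obj.toMatrix = A.obj.toMatrix * B.obj.toMatrix := MatCat.toMatrix_mul _ _

lemma GLCat.toMatrix_unit : (𝟙_ (GLCat R n)).obj.toMatrix = 1 := MatCat.toMatrix_one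

/-- The block sum of matrices of objects (with zero objects off the diagonal blocks), as
a functor `GLₙ(𝓡_R) × GLₘ(𝓡_R) ⥤ GLₙ₊ₘ(𝓡_R)`; all morphisms involved are identities. -/
def GLCat.blockSum (R : Type u) [Ring R] (n m : ℕ) : GLCat R n × GLCat R m ⥤ GLCat R (n + m) where
  obj A :=
    { obj := MatCat.ofMatrix (BimonoidalK.blockSum A.1.obj.toMatrix A.2.obj.toMatrix)
      property := (Prod.isUnit_iff (x := (A.1.obj.toMatrix, A.2.obj.toMatrix)).2
        ⟨A.1.property, A.2.property⟩).map (blockSumHom R n m) }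
  map f := ObjectProperty.homMk (eqToHom (congrArg MatCat.ofMatrix (congrArg₂ _
    (congrArg MatCat.toMatrix (MatCat.eq_of_hom f.1.hom))
    (congrArg MatCat.toMatrix (MatCat.eq_of_hom f.2.hom)))))
  map_id _ := Subsingleton.elim _ _
  map_comp _ _ := Subsingleton.elim _ _

lemma GLCat.toMatrix_blockSum {m : ℕ} (A : GLCat R n) (B : GLCat R m) :
    ((GLCat.blockSum R n m).obj (A, B)).obj.toMatrix =
      BimonoidalK.blockSum A.obj.toMatrix B.obj.toMatrix := rfl

/-- The functor `A ↦ ζ(A)^t` on `GLₙ(𝓡_R)`, given by `ζ(A)^t_{ij} = ζ(A_{ji})` on objects and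
on morphisms. -/
def GLCat.zetaT (R : Type u) [Ring R] [StarRing R] (n : ℕ) : GLCat R n ⥤ GLCat R n where
  obj A :=
    { obj := fun i j => (RCat.zeta R).obj (A.obj j i)
      property := (A.property.star : IsUnit (star A.obj.toMatrix)) }
  map f := ObjectProperty.homMk fun i j => (RCat.zeta R).map (f.hom j i)
  map_id _ := Subsingleton.elim _ _
  map_comp _ _ := Subsingleton.elim _ _

lemma GLCat.toMatrix_zetaT [StarRing R] (A : GLCat R n) :
    ((GLCat.zetaT R n).obj A).obj.toMatrix = A.obj.toMatrix.conjTranspose := rfl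

/-- The structure isomorphism `μ : ζ(A · B)^t ≅ ζ(B)^t · ζ(A)^t` (an identity for `𝓡_R`). -/
def GLCat.mu [StarRing R] (A B : GLCat R n) :
    (GLCat.zetaT R n).obj (A ⊗ B) ≅ (GLCat.zetaT R n).obj B ⊗ (GLCat.zetaT R n).obj A :=
  eqToIso (GLCat.ext (by
    rw [GLCat.toMatrix_tensor, GLCat.toMatrix_zetaT, GLCat.toMatrix_tensor,
      Matrix.conjTranspose_mul, GLCat.toMatrix_zetaT, GLCat.toMatrix_zetaT]))

/-- The isomorphism `(A ⊕ B) · (A' ⊕ B') ≅ (A · A') ⊕ (B · B')` (an identity for `𝓡_R`). -/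
def GLCat.blockSumTensor {m : ℕ} (A A' : GLCat R n) (B B' : GLCat R m) :
    (GLCat.blockSum R n m).obj (A, B) ⊗ (GLCat.blockSum R n m).obj (A', B') ≅
      (GLCat.blockSum R n m).obj (A ⊗ A', B ⊗ B') :=
  eqToIso (GLCat.ext (by
    simp only [GLCat.toMatrix_tensor, GLCat.toMatrix_blockSum]
    exact ((blockSumHom R n m).map_mul (A.obj.toMatrix, B.obj.toMatrix)
      (A'.obj.toMatrix, B'.obj.toMatrix)).symm))

end MatrixCategories

/-! ### Block sum and the involution `τ` on the bar constructions -/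

section Tau

variable {R : Type u} [Ring R] {q : SimplexCategory}

/-- Block sum as a functor `B_q GLₙ(𝓡_R) × B_q GLₘ(𝓡_R) ⥤ B_q GLₙ₊ₘ(𝓡_R)`. -/
def barBlockSum (R : Type u) [Ring R] (q : SimplexCategory) (n m : ℕ) :
    BarObj (GLCat R n) q × BarObj (GLCat R m) q ⥤ BarObj (GLCat R (n + m)) q where
  obj X :=
    { obj := fun i j h => (GLCat.blockSum R n m).obj (X.1.obj i j h, X.2.obj i j h)
      obj_self := fun i => GLCat.ext (by
        rw [X.1.obj_self, X.2.obj_self, GLCat.toMatrix_blockSum]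
        simp only [GLCat.toMatrix_unit]
        exact (blockSumHom R n m).map_one)
      φ := fun i j k hij hjk => GLCat.blockSumTensor _ _ _ _ ≪≫
        (GLCat.blockSum R n m).mapIso (Iso.prod (X.1.φ i j k hij hjk) (X.2.φ i j k hij hjk))
      coherence := fun _ _ _ _ _ _ _ => Subsingleton.elim _ _
      φ_left := fun _ _ _ => Subsingleton.elim _ _
      φ_right := fun _ _ _ => Subsingleton.elim _ _ }
  map F :=
    { f := fun i j h => (GLCat.blockSum R n m).map (Prod.mkHom (F.1.f i j h) (F.2.f i j h))
      f_self := fun _ => Subsingleton.elim _ _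
      comm := fun _ _ _ _ _ => Subsingleton.elim _ _ }
  map_id _ := Subsingleton.elim _ _
  map_comp _ _ := Subsingleton.elim _ _

/-- The functor `τ` on `B_q GLₙ(𝓡_R)`: `τ(A)^{ij} = ζ(A^{q-j,q-i})^t`, with
`τ(φ)^{ijk} = ζ(φ^{q-k,q-j,q-i})^t ∘ μ⁻¹`. -/
def barTau (R : Type u) [Ring R] [StarRing R] (q : SimplexCategory) (n : ℕ) :
    BarObj (GLCat R n) q ⥤ BarObj (GLCat R n) q where
  obj A :=
    { obj := fun i j h => (GLCat.zetaT R n).obj (A.obj j.rev i.rev (Fin.rev_le_rev.2 h))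
      obj_self := fun i => GLCat.ext (by
        rw [A.obj_self, GLCat.toMatrix_zetaT, GLCat.toMatrix_unit, Matrix.conjTranspose_one])
      φ := fun i j k hij hjk => (GLCat.mu _ _).symm ≪≫
        (GLCat.zetaT R n).mapIso
          (A.φ k.rev j.rev i.rev (Fin.rev_le_rev.2 hjk) (Fin.rev_le_rev.2 hij))
      coherence := fun _ _ _ _ _ _ _ => Subsingleton.elim _ _
      φ_left := fun _ _ _ => Subsingleton.elim _ _
      φ_right := fun _ _ _ => Subsingleton.elim _ _ }
  map F :=
    { f := fun i j h => (GLCat.zetaT R n).map (F.f j.rev i.rev (Fin.rev_le_rev.2 h))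
      f_self := fun _ => Subsingleton.elim _ _
      comm := fun _ _ _ _ _ => Subsingleton.elim _ _ }
  map_id _ := Subsingleton.elim _ _
  map_comp _ _ := Subsingleton.elim _ _

end Tau

/-! ### The K-theory of the bimonoidal category `𝓡_R` and its involution -/

section BimonoidalKTheory

/-- The `(q, s)`-simplices of `∐ₙ N(BGLₙ(𝓡_R))`: for each `n` the `s`-simplices of the nerve of
the category `B_q GLₙ(𝓡_R)`. -/
def CatBar (R : Type u) [Ring R] (q s : SimplexCategory) : Type u :=
  Σ n : ℕ, (nerve (BarObj (GLCat R n) q)).obj (op s)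

variable {R : Type u} [Ring R]

/-- The chain of `s` composable morphisms of `B_q GLₙ(𝓡_R)` underlying a simplex. -/
def CatBar.chain {q s : SimplexCategory} (x : CatBar R q s) :
    Fin (s.len + 1) ⥤ BarObj (GLCat R x.1) q := x.2

/-- The matrices of which a simplex of `∐ₙ N(BGLₙ(𝓡_R))` consists. -/
def CatBar.entry {q s : SimplexCategory} (x : CatBar R q s) (t : Fin (s.len + 1))
    (i j : Fin (q.len + 1)) (h : i ≤ j) : SqMat R :=
  ⟨x.1, ((x.chain.obj t).obj i j h).obj.toMatrix⟩

lemma BarObj.ext_of_toMatrix {n : ℕ} {q : SimplexCategory} {A B : BarObj (GLCat R n) q}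
    (H : ∀ i j h, (A.obj i j h).obj.toMatrix = (B.obj i j h).obj.toMatrix) : A = B := by
  obtain ⟨a, _, φ, _, _, _⟩ := A
  obtain ⟨b, _, ψ, _, _, _⟩ := B
  obtain rfl : a = b := by
    funext i j h
    exact GLCat.ext (H i j h)
  congr
  funext i j k hij hjk
  exact Iso.ext (Subsingleton.elim _ _)

lemma CatBar.ext {q s : SimplexCategory} {x y : CatBar R q s}
    (H : ∀ t i j h, x.entry t i j h = y.entry t i j h) : x = y := by
  obtain ⟨n, x⟩ := x
  obtain ⟨m, y⟩ := y
  obtain rfl : n = m := congrArg Sigma.fst (H 0 0 0 le_rfl)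
  refine congrArg (Sigma.mk n) (CategoryTheory.Functor.ext (fun t => ?_) (fun _ _ _ => Subsingleton.elim _ _))
  exact BarObj.ext_of_toMatrix fun i j h => eq_of_heq (Sigma.mk.inj (H t i j h)).2

/-- The object of `B_q(C)` all of whose entries are the unit object. -/
def BarObj.unit (n : ℕ) (q : SimplexCategory) : BarObj (GLCat R n) q where
  obj _ _ _ := 𝟙_ _
  obj_self _ := rfl
  φ _ _ _ _ _ := λ_ _
  coherence _ _ _ _ _ _ _ := Subsingleton.elim _ _
  φ_left _ _ _ := Subsingleton.elim _ _
  φ_right _ _ _ := Subsingleton.elim _ _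

/-- `∐ₙ N(BGLₙ(𝓡_R))` is a monoid under block sum in each bisimplicial degree. -/
instance (q s : SimplexCategory) : Monoid (CatBar R q s) where
  mul x y := ⟨x.1 + y.1, Functor.prod' x.chain y.chain ⋙ barBlockSum R q x.1 y.1⟩
  one := ⟨0, (Functor.const (Fin (s.len + 1))).obj (BarObj.unit 0 q)⟩
  mul_assoc x y z := CatBar.ext fun t i j h =>
    mul_assoc (x.entry t i j h) (y.entry t i j h) (z.entry t i j h)
  one_mul x := CatBar.ext fun t i j h =>
    (congrArg (· * x.entry t i j h)
      (congrArg (Sigma.mk 0) (Subsingleton.elim _ _) : (_ : SqMat R) = 1)).trans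
        (one_mul (x.entry t i j h))
  mul_one x := CatBar.ext fun t i j h =>
    (congrArg (x.entry t i j h * ·)
      (congrArg (Sigma.mk 0) (Subsingleton.elim _ _) : (_ : SqMat R) = 1)).trans
        (mul_one (x.entry t i j h))

/-- The bisimplicial structure of `∐ₙ N(BGLₙ(𝓡_R))`, obtained from the simplicial categories
`BGLₙ(𝓡_R)` by applying the nerve functor. -/
def CatBar.pull {q s q' s' : SimplexCategory} (θ : q' ⟶ q) (σ : s' ⟶ s) (x : CatBar R q s) :
    CatBar R q' s' :=
  ⟨x.1, (nerveFunctor.obj ((barConstruction (GLCat R x.1)).obj (op q'))).map σ.op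
    ((nerveFunctor.map ((barConstruction (GLCat R x.1)).map θ.op)).app (op s) x.2)⟩

lemma CatBar.entry_pull {q s q' s' : SimplexCategory} (θ : q' ⟶ q) (σ : s' ⟶ s)
    (x : CatBar R q s) (t : Fin (s'.len + 1)) (i j : Fin (q'.len + 1)) (h : i ≤ j) :
    (x.pull θ σ).entry t i j h = x.entry (σ.toOrderHom t) (θ.toOrderHom i) (θ.toOrderHom j)
      (θ.toOrderHom.monotone h) := rfl

lemma CatBar.entry_mul {q s : SimplexCategory} (x y : CatBar R q s) (t : Fin (s.len + 1))
    (i j : Fin (q.len + 1)) (h : i ≤ j) :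
    (x * y).entry t i j h = x.entry t i j h * y.entry t i j h := rfl

lemma CatBar.entry_one {q s : SimplexCategory} (t : Fin (s.len + 1))
    (i j : Fin (q.len + 1)) (h : i ≤ j) : (1 : CatBar R q s).entry t i j h = 1 :=
  congrArg (Sigma.mk 0) (Subsingleton.elim _ _)

/-- The bisimplicial monoid `∐ₙ N(BGLₙ(𝓡_R))`: the disjoint union of the nerves of the simplicial
categories `BGLₙ(𝓡_R)`, with block sum. -/
def catBar (R : Type u) [Ring R] : (SimplexCategory × SimplexCategory)ᵒᵖ ⥤ MonCat.{u} where
  obj x := MonCat.of (CatBar R x.unop.1 x.unop.2)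
  map f := MonCat.ofHom
    { toFun := CatBar.pull f.unop.1 f.unop.2
      map_one' := CatBar.ext fun _ _ _ _ => by
        rw [CatBar.entry_pull, CatBar.entry_one, CatBar.entry_one]
      map_mul' := fun _ _ => CatBar.ext fun _ _ _ _ => by
        simp only [CatBar.entry_pull, CatBar.entry_mul] }
  map_id x := by
    ext z
    exact CatBar.ext fun _ _ _ _ => rfl
  map_comp f g := by
    ext z
    exact CatBar.ext fun _ _ _ _ => rfl

/-- The standard simplices `(q, s) ↦ Δ^q × Δ^s`. -/
noncomputable abbrev biSimplexTop : SimplexCategory × SimplexCategory ⥤ TopCat.{0} :=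
  simplexProd simplexTop

/-- The space `B(∐ₙ |BGLₙ(𝓡_R)|)`. -/
abbrev BimonBM (R : Type u) [Ring R] : Type u := ClassifyingSpace biSimplexTop (catBar R)

/-- The base point of `B(∐ₙ |BGLₙ(𝓡_R)|)`. -/
noncomputable def bimonBase (R : Type u) [Ring R] : BimonBM R :=
  ClassifyingSpace.base biSimplexTop (catBar R) (SimplexCategory.mk 0, SimplexCategory.mk 0)
    ((default, default) : SimplexCategory.toTop₀.obj (SimplexCategory.mk 0) ×
      SimplexCategory.toTop₀.obj (SimplexCategory.mk 0))

/-- The K-theory space `𝓚(𝓡_R) = ΩB(∐ₙ |BGLₙ(𝓡_R)|)` of the bimonoidal category `𝓡_R`. -/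
abbrev BimonKSpace (R : Type u) [Ring R] : Type u := LoopSpace (BimonBM R) (bimonBase R)

/-- The homotopy group `π_i(𝓚(𝓡_R))`. -/
abbrev BimonK (R : Type u) [Ring R] (i : ℕ) : Type u :=
  HomotopyGroup.Pi i (BimonKSpace R) (Path.refl (bimonBase R))

/-- The functor reversing the order in the bar direction and leaving the nerve direction
unchanged. -/
abbrev revFst : SimplexCategory × SimplexCategory ⥤ SimplexCategory × SimplexCategory :=
  Functor.prod SimplexCategory.rev (𝟭 SimplexCategory)

/-- `τ` on the `(q, s)`-simplices of `∐ₙ N(BGLₙ(𝓡_R))`: the nerve of the functor `barTau`. -/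
def CatBar.tau [StarRing R] {q s : SimplexCategory} (x : CatBar R q s) : CatBar R q s :=
  ⟨x.1, (nerveMap (barTau R q x.1)).app (op s) x.2⟩

/-- Conjugate transposition on square matrices of arbitrary size. -/
def SqMat.conjT [StarRing R] (x : SqMat R) : SqMat R := ⟨x.1, x.2.conjTranspose⟩

lemma SqMat.conjT_mul [StarRing R] (x y : SqMat R) : (x * y).conjT = x.conjT * y.conjT :=
  congrArg (Sigma.mk (x.1 + y.1)) (conjTranspose_blockSum _ _)

lemma SqMat.conjT_one [StarRing R] : (1 : SqMat R).conjT = 1 :=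
  congrArg (Sigma.mk 0) (Subsingleton.elim _ _)

lemma CatBar.entry_tau [StarRing R] {q s : SimplexCategory} (x : CatBar R q s)
    (t : Fin (s.len + 1)) (i j : Fin (q.len + 1)) (h : i ≤ j) :
    x.tau.entry t i j h = (x.entry t j.rev i.rev (Fin.rev_le_rev.2 h)).conjT := rfl

lemma CatBar.entry_congr {q s : SimplexCategory} (x : CatBar R q s) (t : Fin (s.len + 1))
    {i i' j j' : Fin (q.len + 1)} (h : i ≤ j) (hi : i = i') (hj : j = j') :
    x.entry t i j h = x.entry t i' j' (hi ▸ hj ▸ h) := by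
  subst hi hj
  rfl

lemma CatBar.tau_pull [StarRing R] {q s q' s' : SimplexCategory} (θ : q' ⟶ q) (σ : s' ⟶ s)
    (x : CatBar R q s) : (x.pull θ σ).tau = x.tau.pull (SimplexCategory.rev.map θ) σ := by
  refine CatBar.ext fun t i j h => ?_
  rw [CatBar.entry_tau, CatBar.entry_pull, CatBar.entry_pull, CatBar.entry_tau]
  refine congrArg (SqMat.conjT (R := R)) (CatBar.entry_congr _ _ _ ?_ ?_) <;>
    simp [SimplexCategory.rev_map_apply]

/-- `τ` as a map from the bisimplicial monoid `∐ₙ N(BGLₙ(𝓡_R))` to the same one with the order of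
the simplices in the bar direction reversed. -/
def catBarTau (R : Type u) [Ring R] [StarRing R] : catBar R ⟶ revFst.op ⋙ catBar R where
  app x := MonCat.ofHom (X := CatBar R x.unop.1 x.unop.2) (Y := CatBar R x.unop.1 x.unop.2)
    { toFun := CatBar.tau
      map_one' := CatBar.ext fun _ _ _ _ => by
        rw [CatBar.entry_tau, CatBar.entry_one, CatBar.entry_one, SqMat.conjT_one]
      map_mul' := fun x y => CatBar.ext fun _ _ _ _ => by
        simp only [CatBar.entry_tau, CatBar.entry_mul, SqMat.conjT_mul] }
  naturality x y f := by
    ext z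
    exact CatBar.tau_pull (R := R) f.unop.1 f.unop.2 z

lemma stdSimplex_map_rev {p q : SimplexCategory} (f : p ⟶ q)
    (t : stdSimplex ℝ (Fin (p.len + 1))) :
    stdSimplex.map Fin.rev (stdSimplex.map f.toOrderHom t) =
      stdSimplex.map (SimplexCategory.rev.map f).toOrderHom (stdSimplex.map Fin.rev t) := by
  rw [stdSimplex.map_comp_apply, stdSimplex.map_comp_apply]
  congr 1
  funext i
  simp [SimplexCategory.rev_map_apply]

/-- The homeomorphism of `Δ^q` reversing the barycentric coordinates. -/
noncomputable def simplexFlip : simplexTop ⟶ SimplexCategory.rev ⋙ simplexTop where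
  app q := TopCat.ofHom (X := stdSimplex ℝ (Fin (q.len + 1)))
    (Y := stdSimplex ℝ (Fin (q.len + 1)))
    ⟨stdSimplex.map (Fin.rev : Fin (q.len + 1) → Fin (q.len + 1)), stdSimplex.continuous_map _⟩
  naturality p q f := by
    ext t
    exact stdSimplex_map_rev f t

/-- The flip of `Δ^q × Δ^s` in the first factor. -/
noncomputable def biSimplexFlip : biSimplexTop ⟶ revFst ⋙ biSimplexTop where
  app x := TopCat.ofHom ((simplexFlip.app x.1).hom.prodMap (ContinuousMap.id _))
  naturality x y f := by
    ext t
    refine Prod.ext ?_ ?_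
    · exact ConcreteCategory.congr_hom (simplexFlip.naturality f.1) t.1
    · rfl

/-- The map induced by `τ` on `B(∐ₙ |BGLₙ(𝓡_R)|)`: on the realisation of `BGLₙ(𝓡_R)` it applies `τ`
to simplices and reverses the coordinates of the standard simplices in the bar direction. -/
noncomputable def tauBM (R : Type u) [Ring R] [StarRing R] : C(BimonBM R, BimonBM R) :=
  ClassifyingSpace.map revFst (catBarTau R) biSimplexFlip

lemma tauBM_base (R : Type u) [Ring R] [StarRing R] : tauBM R (bimonBase R) = bimonBase R := by
  refine (ClassifyingSpace.map_base _ _ _ _ _).trans ?_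
  refine congrArg (ClassifyingSpace.base biSimplexTop (catBar R)
    (SimplexCategory.mk 0, SimplexCategory.mk 0)) (Prod.ext ?_ rfl)
  exact Subsingleton.elim (α := SimplexCategory.toTop₀.obj (SimplexCategory.mk 0)) _ _

/-- The involution on `𝓚(𝓡_R)` induced by `τ`. -/
noncomputable def tauSpace (R : Type u) [Ring R] [StarRing R] : C(BimonKSpace R, BimonKSpace R) :=
  loopMap (tauBM R) (tauBM_base R)

/-- The involution on `π_i(𝓚(𝓡_R))` induced by `τ`. -/
noncomputable def tauK (R : Type u) [Ring R] [StarRing R] (i : ℕ) : BimonK R i → BimonK R i :=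
  homotopyGroupMap (Fin i) (tauSpace R) (loopMap_refl _ _)

end BimonoidalKTheory

/-! ### The comparison `K(R) → 𝓚(𝓡_R)` -/

section Comparison

variable {R : Type u} [Ring R]

/-- The object of `B_q GLₙ(𝓡_R)` given by a `q`-simplex of the ordinary bar construction of
`GLₙ(R)`: the entries `A^{ij}` are the iterated products and the `φ^{ijk}` are identities. -/
def triangle {n : ℕ} {q : SimplexCategory} (x : MonoidBar (GL' R n) q) :
    BarObj (GLCat R n) q where
  obj i j h :=
    { obj := MatCat.ofMatrix (x.a i j h).val
      property := (x.a i j h).isUnit }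
  obj_self i := GLCat.ext (by rw [x.a_self, GLCat.toMatrix_unit]; rfl)
  φ i j k hij hjk := eqToIso (GLCat.ext (by
    rw [GLCat.toMatrix_tensor]
    exact congrArg Units.val (x.a_mul i j k hij hjk)))
  coherence _ _ _ _ _ _ _ := Subsingleton.elim _ _
  φ_left _ _ _ := Subsingleton.elim _ _
  φ_right _ _ _ := Subsingleton.elim _ _

/-- A simplex of `∐ₙ BGLₙ(R)` viewed as a simplex of `∐ₙ N(BGLₙ(𝓡_R))` of nerve degree zero. -/
def GLBar.toCatBar {q : SimplexCategory} (x : GLBar R q) : CatBar R q (SimplexCategory.mk 0) :=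
  ⟨x.1, (Functor.const (Fin 1)).obj (triangle x.2)⟩

lemma GLBar.entry_toCatBar {q : SimplexCategory} (x : GLBar R q) (t : Fin 1)
    (i j : Fin (q.len + 1)) (h : i ≤ j) : x.toCatBar.entry t i j h = x.entry i j h := rfl

/-- The functor `q ↦ (q, 0)`. -/
abbrev inclFst : SimplexCategory ⥤ SimplexCategory × SimplexCategory :=
  Functor.prod' (𝟭 SimplexCategory) ((Functor.const SimplexCategory).obj (SimplexCategory.mk 0))

/-- The comparison map of simplicial monoids from the ordinary bar constructions to the vertices
in the nerve direction of the bar constructions of `GLₙ(𝓡_R)`. -/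
def barComparison (R : Type u) [Ring R] : glBar R ⟶ inclFst.op ⋙ catBar R where
  app q := MonCat.ofHom (X := GLBar R q.unop) (Y := CatBar R q.unop (SimplexCategory.mk 0))
    { toFun := GLBar.toCatBar
      map_one' := CatBar.ext fun _ _ _ _ => congrArg (Sigma.mk 0) (Subsingleton.elim _ _)
      map_mul' := fun _ _ => CatBar.ext fun _ _ _ _ => rfl }
  naturality x y f := by
    ext z
    exact CatBar.ext fun _ _ _ _ => rfl

/-- `Δ^q ≅ Δ^q × Δ^0`. -/
noncomputable def simplexIncl : simplexTop ⟶ inclFst ⋙ biSimplexTop where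
  app q := TopCat.ofHom (Y := SimplexCategory.toTop₀.obj q ×
      SimplexCategory.toTop₀.obj (SimplexCategory.mk 0))
    ((ContinuousMap.id _).prodMk (ContinuousMap.const _ default))
  naturality p q f := by
    ext t
    refine Prod.ext ?_ ?_
    · rfl
    · exact Subsingleton.elim (α := SimplexCategory.toTop₀.obj (SimplexCategory.mk 0)) _ _

/-- The comparison map `B(∐ₙ |BGLₙ(R)|) → B(∐ₙ |BGLₙ(𝓡_R)|)`. -/
noncomputable def comparisonBM (R : Type u) [Ring R] : C(RingBM R, BimonBM R) :=
  ClassifyingSpace.map inclFst (barComparison R) simplexIncl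

lemma comparisonBM_base (R : Type u) [Ring R] : comparisonBM R (ringBase R) = bimonBase R :=
  ClassifyingSpace.map_base _ _ _ _ _

/-- The comparison map `K(R) → 𝓚(𝓡_R)`. -/
noncomputable def comparisonSpace (R : Type u) [Ring R] : C(RingKSpace R, BimonKSpace R) :=
  loopMap (comparisonBM R) (comparisonBM_base R)

/-- The comparison map `K_i(R) → π_i(𝓚(𝓡_R))`. -/
noncomputable def comparisonK (R : Type u) [Ring R] (i : ℕ) : RingK R i → BimonK R i :=
  homotopyGroupMap (Fin i) (comparisonSpace R) (loopMap_refl _ _)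

end Comparison

end BimonoidalK

/-!
The comparison map is induced by a homeomorphism, and the two involutions correspond to each other
up to a homotopy which comes from reversing the order of the vertices of simplices.

*The isomorphism.*  The category `𝓡_R` has only identity morphisms, hence so do the categories
`B_q GLₙ(𝓡_R)`, and an object of `B_q GLₙ(𝓡_R)` is just a `q`-simplex of `BGLₙ(R)`.  The
bisimplicial monoid `∐ₙ N(BGLₙ(𝓡_R))` is therefore constant in the nerve direction
(`CatBar.entry_eq`), and forgetting that direction is inverse to `comparisonBM`
(`collapseBM_comparisonBM`, `comparisonBM_collapseBM`).

*The involutions.*  For a simplex `a i j` of `BGLₙ(R)`, the classical involution gives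
`((a i j)ᴴ)⁻¹`, and `τ` gives `(a (q - j) (q - i))ᴴ` with reversed barycentric coordinates.  Thus
`τ` is the classical involution followed by the flip
`[a i j, t] ↦ [(a (q - j) (q - i))⁻¹, rev t]` (`tauBM_comparisonBM`), and it remains to deform the
flip to the identity through a homotopy compatible with block sums.  As the entries are invertible,
a functor `[q] → G` extends to the chaotic groupoid on the vertices of `[q]`, and so can be pulled
back along the folding map `[q] * [q]ᵒᵖ = [2q+1] → [q]`, although this map is not monotone.  The
resulting natural `(2q+1)`-simplex `double a` has `a` as its front face and the flip of `a` as its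
back face, so `(s, [a, t]) ↦ [double a, ((1 - s) t, s t)]` is the required homotopy
(`doublingBM_homotopicRel`).  Doubling is a homomorphism for block sums, which is why the homotopy
exists on the classifying space of `∐ₙ |BGLₙ(R)|`; it fixes the base point, and so becomes an
equality on homotopy groups of loop spaces (`loopHomotopyGroupMap_congr`).
-/

namespace BimonoidalK

/-! ### Homotopy groups of loop spaces -/

section LoopHomotopyGroups

open scoped Topology Topology.Homotopy unitInterval

variable {X Y Z : Type u} [TopologicalSpace X] [TopologicalSpace Y] [TopologicalSpace Z]

lemma homotopyGroupMap_mk (N : Type) (f : C(X, Y)) {x : X} {y : Y} (h : f x = y)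
    (γ : GenLoop N X x) :
    homotopyGroupMap N f h (Quotient.mk _ γ) = Quotient.mk _ ⟨f.comp γ.1, fun t ht => by
      rw [ContinuousMap.comp_apply, ← h]; exact congrArg f (γ.2 t ht)⟩ := rfl

lemma homotopyGroupMap_id (N : Type) {x : X} (z : HomotopyGroup N X x) :
    homotopyGroupMap N (ContinuousMap.id X) (x := x) rfl z = z := by
  induction z using Quotient.inductionOn with | _ γ => rfl

lemma homotopyGroupMap_comp (N : Type) (f : C(X, Y)) (g : C(Y, Z)) {x : X} {y : Y} {z : Z}
    (hf : f x = y) (hg : g y = z) (hgf : (g.comp f) x = z) (w : HomotopyGroup N X x) :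
    homotopyGroupMap N g hg (homotopyGroupMap N f hf w) = homotopyGroupMap N (g.comp f) hgf w := by
  induction w using Quotient.inductionOn with | _ γ => rfl

lemma homotopyGroupMap_mul (N : Type) [DecidableEq N] [Nonempty N] (f : C(X, Y)) {x : X} {y : Y}
    (h : f x = y) (v w : HomotopyGroup N X x) :
    homotopyGroupMap N f h (v * w) = homotopyGroupMap N f h v * homotopyGroupMap N f h w := by
  induction v using Quotient.inductionOn with | _ γ =>
  induction w using Quotient.inductionOn with | _ δ =>
  have e1 := HomotopyGroup.mul_spec (i := Classical.arbitrary N) (p := γ) (q := δ)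
  dsimp only at e1
  rw [e1, homotopyGroupMap_mk, homotopyGroupMap_mk, homotopyGroupMap_mk]
  refine Eq.trans ?_ (HomotopyGroup.mul_spec (i := Classical.arbitrary N)).symm
  refine congrArg (Quotient.mk _) (GenLoop.ext _ _ fun t => ?_)
  exact apply_ite f _ _ _

/-- A homotopy relative to the base point induces a homotopy of maps of loop spaces relative to
the constant loop. -/
lemma loopMap_homotopicRel {f g : C(X, Y)} {x : X} {y : Y} (hf : f x = y) (hg : g x = y)
    (H : f.HomotopicRel g {x}) :
    (loopMap f hf).HomotopicRel (loopMap g hg) {Path.refl x} := by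
  obtain ⟨H⟩ := H
  have hx : ∀ s, H (s, x) = y := fun s => (H.eq_fst s rfl).trans hf
  refine ⟨⟨⟨⟨fun p => ⟨⟨fun u => H (p.1, p.2 u), by fun_prop⟩, ?_, ?_⟩, ?_⟩, ?_, ?_⟩, ?_⟩⟩
  · simp [hx]
  · simp [hx]
  · refine Path.continuous_uncurry_iff.1 ?_
    change Continuous fun p : (I × Path x x) × I => H (p.1.1, p.1.2 p.2)
    fun_prop
  · intro γ
    ext u
    exact H.apply_zero (γ u)
  · intro γ
    ext u
    exact H.apply_one (γ u)
  · rintro s _ rfl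
    ext u
    exact H.eq_fst s rfl

lemma homotopyGroupMap_congr (N : Type) {f g : C(X, Y)} {x : X} {y : Y} (hf : f x = y)
    (hg : g x = y) (H : f.HomotopicRel g {x}) :
    homotopyGroupMap N f hf = homotopyGroupMap N g hg := by
  funext w
  induction w using Quotient.inductionOn with | _ γ =>
  obtain ⟨H⟩ := H
  refine Quotient.sound ⟨⟨⟨H.toContinuousMap.comp
    ((ContinuousMap.id I).prodMap γ.1), fun t => H.apply_zero _, fun t => H.apply_one _⟩, ?_⟩⟩
  intro s t ht
  exact H.eq_fst s (γ.2 t ht)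

/-- The map `π_N(ΩX) → π_N(ΩY)` induced by a pointed map `X → Y`. -/
def loopHomotopyGroupMap (N : Type) (f : C(X, Y)) {x : X} {y : Y} (h : f x = y) :
    HomotopyGroup N (LoopSpace X x) (Path.refl x) → HomotopyGroup N (LoopSpace Y y) (Path.refl y) :=
  homotopyGroupMap N (loopMap f h) (loopMap_refl f h)

lemma loopHomotopyGroupMap_id (N : Type) {x : X} {f : C(X, X)} (hf : f = ContinuousMap.id X)
    (h : f x = x) (z : HomotopyGroup N (LoopSpace X x) (Path.refl x)) :
    loopHomotopyGroupMap N f h z = z := by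
  subst hf
  exact homotopyGroupMap_id N z

lemma loopHomotopyGroupMap_comp (N : Type) (f : C(X, Y)) (g : C(Y, Z)) {x : X} {y : Y} {z : Z}
    (hf : f x = y) (hg : g y = z) (hgf : (g.comp f) x = z)
    (w : HomotopyGroup N (LoopSpace X x) (Path.refl x)) :
    loopHomotopyGroupMap N g hg (loopHomotopyGroupMap N f hf w) =
      loopHomotopyGroupMap N (g.comp f) hgf w :=
  homotopyGroupMap_comp N (loopMap f hf) (loopMap g hg) _ _ _ w

lemma loopHomotopyGroupMap_congr (N : Type) {f g : C(X, Y)} {x : X} {y : Y} (hf : f x = y)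
    (hg : g x = y) (H : f.HomotopicRel g {x}) :
    loopHomotopyGroupMap N f hf = loopHomotopyGroupMap N g hg :=
  homotopyGroupMap_congr N _ _ (loopMap_homotopicRel hf hg H)

end LoopHomotopyGroups

/-! ### Homotopies of realisations -/

section RealizationHomotopy

variable {J J' : Type} [SmallCategory J] [SmallCategory J']

lemma Realization.mk_surjective {Δ : J ⥤ TopCat.{0}} {X : Jᵒᵖ ⥤ Type u} (z : Realization Δ X) :
    ∃ j x t, Realization.mk Δ X j x t = z := by
  obtain ⟨⟨⟨j, x⟩, t⟩, rfl⟩ := Quot.exists_rep z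
  exact ⟨j, x, t, rfl⟩

lemma Realization.mk_map {Δ : J ⥤ TopCat.{0}} {X : Jᵒᵖ ⥤ Type u} {j k : J} (f : j ⟶ k)
    (x : X.obj (op k)) (t : Δ.obj j) :
    Realization.mk Δ X j (X.map f.op x) t = Realization.mk Δ X k x (Δ.map f t) :=
  Quot.sound (RealizationRel.glue f x t)

lemma Realization.continuous_mk {Δ : J ⥤ TopCat.{0}} {X : Jᵒᵖ ⥤ Type u} (j : J)
    (x : X.obj (op j)) : Continuous (Realization.mk Δ X j x) :=
  continuous_quot_mk.comp (continuous_sigmaMk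
    (σ := fun y : (Σ j : J, X.obj (op j)) => Δ.obj y.1) (i := ⟨j, x⟩))

/-- The maps of realisations induced by a jointly continuous family of natural maps of simplices
are jointly continuous.  As `[0,1]` is locally compact, this may be checked on the adjoint map
into the space of paths, hence before passing to the quotient. -/
lemma Realization.continuous_map_family {Δ : J ⥤ TopCat.{0}} {X : Jᵒᵖ ⥤ Type u}
    {Δ' : J' ⥤ TopCat.{0}} {Y : J'ᵒᵖ ⥤ Type u} (ρ : J ⥤ J') (a : X ⟶ ρ.op ⋙ Y)
    (b : unitInterval → (Δ ⟶ ρ ⋙ Δ'))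
    (hb : ∀ j, Continuous fun p : unitInterval × Δ.obj j => ((b p.1).app j p.2 : Δ'.obj (ρ.obj j))) :
    Continuous fun p : unitInterval × Realization Δ X => Realization.map ρ a (b p.1) p.2 := by
  let F : Realization Δ X → C(unitInterval, Realization Δ' Y) := fun z =>
    ⟨fun s => Realization.map ρ a (b s) z, by
      obtain ⟨j, x, t, rfl⟩ := Realization.mk_surjective z
      exact (Realization.continuous_mk (ρ.obj j) (a.app _ x)).comp
        ((hb j).comp (Continuous.prodMk_left t))⟩
  have hF : Continuous F := by
    refine continuous_coinduced_dom.2 (continuous_sigma fun y => ?_)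
    refine ContinuousMap.continuous_of_continuous_uncurry _ ?_
    exact (Realization.continuous_mk (ρ.obj y.1) (a.app _ y.2)).comp
      ((hb y.1).comp continuous_swap)
  exact (ContinuousMap.continuous_uncurry_of_continuous ⟨F, hF⟩).comp continuous_swap

end RealizationHomotopy

/-! ### Doubling of simplices -/

section Doubling

/-- The inclusion of `[q]` into `[2q+1]` as the lower half. -/
def lower {q : ℕ} (i : Fin (q + 1)) : Fin (2 * q + 1 + 1) := ⟨i, by omega⟩

/-- The order-reversing inclusion of `[q]` into `[2q+1]` as the upper half. -/
def upper {q : ℕ} (i : Fin (q + 1)) : Fin (2 * q + 1 + 1) := (lower i).rev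

/-- The (non-monotone) folding map `[2q+1] → [q]`, a retraction of both `lower` and `upper`. -/
def fold {q : ℕ} (k : Fin (2 * q + 1 + 1)) : Fin (q + 1) :=
  if h : k.1 < q + 1 then ⟨k, h⟩ else ⟨2 * q + 1 - k, by omega⟩

@[simp]
lemma fold_lower {q : ℕ} (i : Fin (q + 1)) : fold (lower i) = i := by
  exact dif_pos i.2

@[simp]
lemma fold_upper {q : ℕ} (i : Fin (q + 1)) : fold (upper i) = i := by
  have := i.2
  have h : ¬ (upper i).1 < q + 1 := by
    simp only [upper, lower, Fin.val_rev]
    omega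
  rw [fold, dif_neg h]
  ext
  simp only [upper, lower, Fin.val_rev]
  omega

lemma lower_or_upper {q : ℕ} (k : Fin (2 * q + 1 + 1)) :
    k = lower (fold k) ∨ k = upper (fold k) := by
  by_cases h : k.1 < q + 1
  · exact Or.inl (by rw [fold, dif_pos h]; rfl)
  · right
    rw [fold, dif_neg h]
    ext
    simp only [upper, lower, Fin.val_rev]
    omega

lemma lower_lt_upper {q : ℕ} (i j : Fin (q + 1)) : lower i < upper j := by
  simp only [upper, lower, Fin.lt_def, Fin.val_rev]
  omega

lemma upper_le_upper {q : ℕ} {i j : Fin (q + 1)} : upper i ≤ upper j ↔ j ≤ i :=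
  Fin.rev_le_rev

/-- The map `[2p+1] → [2q+1]` given by a map `[p] → [q]` on both halves. -/
def doubleMap {p q : ℕ} (f : Fin (p + 1) → Fin (q + 1)) (k : Fin (2 * p + 1 + 1)) :
    Fin (2 * q + 1 + 1) :=
  if k = lower (fold k) then lower (f (fold k)) else upper (f (fold k))

@[simp]
lemma doubleMap_lower {p q : ℕ} (f : Fin (p + 1) → Fin (q + 1)) (i : Fin (p + 1)) :
    doubleMap f (lower i) = lower (f i) := by
  simp [doubleMap]

@[simp]
lemma doubleMap_upper {p q : ℕ} (f : Fin (p + 1) → Fin (q + 1)) (i : Fin (p + 1)) :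
    doubleMap f (upper i) = upper (f i) := by
  simp [doubleMap, (lower_lt_upper i i).ne']

lemma fold_doubleMap {p q : ℕ} (f : Fin (p + 1) → Fin (q + 1)) (k : Fin (2 * p + 1 + 1)) :
    fold (doubleMap f k) = f (fold k) := by
  rcases lower_or_upper k with h | h <;> rw [h] <;> simp

lemma doubleMap_monotone {p q : ℕ} {f : Fin (p + 1) → Fin (q + 1)} (hf : Monotone f) :
    Monotone (doubleMap f) := by
  intro k l hkl
  rcases lower_or_upper k with hk | hk <;> rcases lower_or_upper l with hl | hl <;>
    rw [hk, hl] at hkl ⊢ <;> simp only [doubleMap_lower, doubleMap_upper]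
  · exact hf hkl
  · exact (lower_lt_upper _ _).le
  · exact absurd hkl (lower_lt_upper _ _).not_ge
  · exact upper_le_upper.2 (hf (upper_le_upper.1 hkl))

/-- The doubling functor `[q] ↦ [q] * [q]ᵒᵖ = [2q+1]` on the simplex category. -/
def doubling : SimplexCategory ⥤ SimplexCategory where
  obj q := SimplexCategory.mk (2 * q.len + 1)
  map θ := SimplexCategory.Hom.mk ⟨doubleMap θ.toOrderHom, doubleMap_monotone θ.toOrderHom.monotone⟩
  map_id q := by
    ext k : 3
    change doubleMap id k = k
    rcases lower_or_upper k with h | h <;> rw [h] <;> simp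
  map_comp θ η := by
    ext k : 3
    change doubleMap (η.toOrderHom ∘ θ.toOrderHom) k =
      doubleMap η.toOrderHom (doubleMap θ.toOrderHom k)
    rcases lower_or_upper k with h | h <;> rw [h] <;> simp

/-- The inclusion of `[q]` into its double as the lower half. -/
def lowerHom (q : SimplexCategory) : q ⟶ doubling.obj q :=
  SimplexCategory.Hom.mk ⟨fun i => lower i, fun _ _ h => h⟩

/-- The inclusion of `[q]`, with reversed order, into its double as the upper half. -/
def upperHom (q : SimplexCategory) : q ⟶ doubling.obj q :=
  SimplexCategory.Hom.mk ⟨fun i => upper i.rev, fun _ _ h => upper_le_upper.2 (Fin.rev_le_rev.2 h)⟩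

/-- The point `((1 - s) t, s t)` of the simplex on the vertices of `[q] * [q]ᵒᵖ`. -/
noncomputable def doublePoint {q : ℕ} (s : unitInterval) (t : stdSimplex ℝ (Fin (q + 1))) :
    stdSimplex ℝ (Fin (2 * q + 1 + 1)) :=
  ⟨(1 - (s : ℝ)) • (stdSimplex.map lower t).1 + (s : ℝ) • (stdSimplex.map upper t).1,
    convex_stdSimplex ℝ _ (stdSimplex.map lower t).2 (stdSimplex.map upper t).2
      (sub_nonneg.2 s.2.2) s.2.1 (sub_add_cancel _ _)⟩

lemma continuous_doublePoint {q : ℕ} :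
    Continuous fun p : unitInterval × stdSimplex ℝ (Fin (q + 1)) => doublePoint p.1 p.2 := by
  have h1 := stdSimplex.continuous_map (S := ℝ) (lower (q := q))
  have h2 := stdSimplex.continuous_map (S := ℝ) (upper (q := q))
  have hs : Continuous fun p : unitInterval × stdSimplex ℝ (Fin (q + 1)) => (p.1 : ℝ) := by
    fun_prop
  refine Continuous.subtype_mk (Continuous.add
    (Continuous.smul (continuous_const.sub hs) ?_) (Continuous.smul hs ?_)) _
  · exact continuous_subtype_val.comp (h1.comp continuous_snd)
  · exact continuous_subtype_val.comp (h2.comp continuous_snd)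

lemma doublePoint_zero {q : ℕ} (t : stdSimplex ℝ (Fin (q + 1))) :
    doublePoint 0 t = stdSimplex.map lower t := by
  apply Subtype.ext
  simp [doublePoint]

lemma doublePoint_one {q : ℕ} (t : stdSimplex ℝ (Fin (q + 1))) :
    doublePoint 1 t = stdSimplex.map upper t := by
  apply Subtype.ext
  simp [doublePoint]

lemma map_doublePoint {p q : ℕ} (f : Fin (p + 1) → Fin (q + 1)) (s : unitInterval)
    (t : stdSimplex ℝ (Fin (p + 1))) :
    stdSimplex.map (doubleMap f) (doublePoint s t) = doublePoint s (stdSimplex.map f t) := by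
  apply Subtype.ext
  have hl : (doubleMap f) ∘ lower = lower ∘ f := funext fun i => doubleMap_lower f i
  have hu : (doubleMap f) ∘ upper = upper ∘ f := funext fun i => doubleMap_upper f i
  have h1 := congrArg Subtype.val (stdSimplex.map_comp_apply lower (doubleMap f) t)
  have h2 := congrArg Subtype.val (stdSimplex.map_comp_apply upper (doubleMap f) t)
  rw [hl, ← stdSimplex.map_comp_apply f lower] at h1
  rw [hu, ← stdSimplex.map_comp_apply f upper] at h2
  change _ = (1 - (s : ℝ)) • (stdSimplex.map lower (stdSimplex.map f t)).1 +
    (s : ℝ) • (stdSimplex.map upper (stdSimplex.map f t)).1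
  rw [← h1, ← h2]
  change FunOnFinite.linearMap ℝ ℝ (doubleMap f) (_ + _) = _
  rw [map_add, map_smul, map_smul]
  rfl

/-- The natural map `Δ^q → Δ^{2q+1}`, `t ↦ ((1 - s) t, s t)`. -/
noncomputable def simplexDouble (s : unitInterval) : simplexTop ⟶ doubling ⋙ simplexTop where
  app q := TopCat.ofHom (X := stdSimplex ℝ (Fin (q.len + 1)))
    (Y := stdSimplex ℝ (Fin (2 * q.len + 1 + 1)))
    ⟨doublePoint s, continuous_doublePoint.comp (Continuous.prodMk_right s)⟩
  naturality p q f := by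
    ext t
    exact (map_doublePoint _ s t).symm

end Doubling

/-! ### Doubling in the bar construction of a group -/

section GroupBar

namespace MonoidBar

variable {G : Type u} [Group G] {H : Type v} [Group H] {q : SimplexCategory}

/-- The value at an arbitrary pair of vertices of the extension of a functor `[q] → G` to the
chaotic groupoid on the vertices. -/
def chaotic (x : MonoidBar G q) (i j : Fin (q.len + 1)) : G :=
  (x.a 0 i (Fin.zero_le i))⁻¹ * x.a 0 j (Fin.zero_le j)

lemma chaotic_of_le (x : MonoidBar G q) {i j : Fin (q.len + 1)} (h : i ≤ j) :
    x.chaotic i j = x.a i j h := by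
  rw [chaotic, inv_mul_eq_iff_eq_mul, x.a_mul]

lemma chaotic_self (x : MonoidBar G q) (i : Fin (q.len + 1)) : x.chaotic i i = 1 :=
  inv_mul_cancel _

lemma chaotic_mul (x : MonoidBar G q) (i j k : Fin (q.len + 1)) :
    x.chaotic i j * x.chaotic j k = x.chaotic i k := by
  simp [chaotic, mul_assoc]

lemma chaotic_inv (x : MonoidBar G q) (i j : Fin (q.len + 1)) :
    (x.chaotic i j)⁻¹ = x.chaotic j i := by
  simp [chaotic]

lemma chaotic_pull {p : SimplexCategory} (θ : q ⟶ p) (x : MonoidBar G p)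
    (i j : Fin (q.len + 1)) :
    (x.pull θ).chaotic i j = x.chaotic (θ.toOrderHom i) (θ.toOrderHom j) := by
  rw [chaotic, ← chaotic_mul x _ (θ.toOrderHom 0) _, ← chaotic_inv x (θ.toOrderHom 0),
    chaotic_of_le, chaotic_of_le]
  rfl

/-- The simplex of dimension `2q + 1` whose vertices are those of `x`, followed by the same
vertices in reversed order. -/
def double (x : MonoidBar G q) : MonoidBar G (doubling.obj q) where
  a k l _ := x.chaotic (fold k) (fold l)
  a_self _ := x.chaotic_self _
  a_mul _ _ _ _ _ := x.chaotic_mul _ _ _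

lemma double_pull {p : SimplexCategory} (θ : q ⟶ p) (x : MonoidBar G p) :
    (x.pull θ).double = x.double.pull (doubling.map θ) := by
  apply MonoidBar.ext
  funext k l h
  exact (chaotic_pull θ x _ _).trans
    (congrArg₂ x.chaotic (fold_doubleMap θ.toOrderHom k) (fold_doubleMap θ.toOrderHom l)).symm

lemma double_pull_lower (x : MonoidBar G q) : x.double.pull (lowerHom q) = x := by
  apply MonoidBar.ext
  funext i j h
  change x.chaotic (fold (lower i)) (fold (lower j)) = _
  rw [fold_lower, fold_lower, chaotic_of_le x h]

lemma double_pull_upper_a (x : MonoidBar G q) {i j : Fin (q.len + 1)} (h : i ≤ j) :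
    (x.double.pull (upperHom q)).a i j h = (x.a j.rev i.rev (Fin.rev_le_rev.2 h))⁻¹ := by
  change x.chaotic (fold (upper i.rev)) (fold (upper j.rev)) = _
  rw [fold_upper, fold_upper, ← chaotic_inv, chaotic_of_le]

end MonoidBar

variable (R : Type u) [Ring R]

/-- Doubling of simplices as a map of simplicial monoids. -/
def glBarDouble : glBar R ⟶ doubling.op ⋙ glBar R where
  app q := MonCat.ofHom (X := GLBar R q.unop) (Y := GLBar R (doubling.obj q.unop))
    { toFun := fun x => ⟨x.1, x.2.double⟩
      map_one' := GLBar.ext fun _ _ _ => congrArg (Sigma.mk 0) (Subsingleton.elim _ _)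
      map_mul' := fun x y => by
        refine congrArg (Sigma.mk (x.1 + y.1)) (MonoidBar.ext ?_)
        funext k l h
        change (glBlockSum R x.1 y.1 _)⁻¹ * glBlockSum R x.1 y.1 _ = glBlockSum R x.1 y.1 _
        rw [← map_inv, ← map_mul]
        rfl }
  naturality p q f := by
    ext x
    exact congrArg (Sigma.mk x.1) (MonoidBar.double_pull f.unop x.2)

end GroupBar

/-! ### Homotopies of classifying spaces -/

section ClassifyingSpaceHomotopy

variable {J J' : Type} [SmallCategory J] [SmallCategory J']

lemma ClassifyingSpace.mk_surjective {Δ : J ⥤ TopCat.{0}} {M : Jᵒᵖ ⥤ MonCat.{u}}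
    (z : ClassifyingSpace Δ M) : ∃ (p : SimplexCategory) (j : J) (x : MonoidBar (M.obj (op j)) p)
      (w : SimplexCategory.toTop₀.obj p) (t : Δ.obj j),
      Realization.mk (simplexProd Δ) (degreewiseBar M) (p, j) x (w, t) = z := by
  obtain ⟨⟨p, j⟩, x, ⟨w, t⟩, rfl⟩ := Realization.mk_surjective z
  exact ⟨p, j, x, w, t, rfl⟩

/-- The gluing relation along a morphism of `J`. -/
lemma ClassifyingSpace.mk_map {Δ : J ⥤ TopCat.{0}} {M : Jᵒᵖ ⥤ MonCat.{u}} (p : SimplexCategory)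
    {j k : J} (f : j ⟶ k) (x : MonoidBar (M.obj (op k)) p) (w : SimplexCategory.toTop₀.obj p)
    (t : Δ.obj j) :
    Realization.mk (simplexProd Δ) (degreewiseBar M) (p, j) (x.map (M.map f.op).hom) (w, t) =
      Realization.mk (simplexProd Δ) (degreewiseBar M) (p, k) x (w, Δ.map f t) := by
  refine (Realization.mk_map (Δ := simplexProd Δ) (X := degreewiseBar M)
    (j := (p, j)) (k := (p, k)) (𝟙 p, f) x (w, t)).trans ?_
  refine congrArg (Realization.mk (simplexProd Δ) (degreewiseBar M) (p, k) x) (Prod.ext ?_ rfl)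
  exact ConcreteCategory.congr_hom (SimplexCategory.toTop₀.map_id p) w

lemma ClassifyingSpace.map_mk {Δ : J ⥤ TopCat.{0}} {M : Jᵒᵖ ⥤ MonCat.{u}} {Δ' : J' ⥤ TopCat.{0}}
    {N : J'ᵒᵖ ⥤ MonCat.{u}} (ρ : J ⥤ J') (a : M ⟶ ρ.op ⋙ N) (b : Δ ⟶ ρ ⋙ Δ')
    (p : SimplexCategory) (j : J) (x : MonoidBar (M.obj (op j)) p)
    (w : SimplexCategory.toTop₀.obj p) (t : Δ.obj j) :
    ClassifyingSpace.map ρ a b (Realization.mk (simplexProd Δ) (degreewiseBar M) (p, j) x (w, t)) =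
      Realization.mk (simplexProd Δ') (degreewiseBar N) (p, ρ.obj j)
        (MonoidBar.map (a.app (op j)).hom x) (w, b.app j t) := rfl

lemma ClassifyingSpace.base_eq {Δ : J ⥤ TopCat.{0}} {M : Jᵒᵖ ⥤ MonCat.{u}} {j k : J} (f : j ⟶ k)
    (t : Δ.obj j) :
    ClassifyingSpace.base Δ M j t = ClassifyingSpace.base Δ M k (Δ.map f t) := by
  refine Eq.trans ?_ (ClassifyingSpace.mk_map (SimplexCategory.mk 0) f 1 default t)
  refine congrArg (fun x => Realization.mk (simplexProd Δ) (degreewiseBar M)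
    (SimplexCategory.mk 0, j) x (default, t)) ?_
  apply MonoidBar.ext
  funext _ _ _
  exact (map_one (M.map f.op).hom).symm

lemma ClassifyingSpace.continuous_map_family {Δ : J ⥤ TopCat.{0}} {M : Jᵒᵖ ⥤ MonCat.{u}}
    {Δ' : J' ⥤ TopCat.{0}} {N : J'ᵒᵖ ⥤ MonCat.{u}} (ρ : J ⥤ J') (a : M ⟶ ρ.op ⋙ N)
    (b : unitInterval → (Δ ⟶ ρ ⋙ Δ'))
    (hb : ∀ j, Continuous fun p : unitInterval × Δ.obj j =>
      ((b p.1).app j p.2 : Δ'.obj (ρ.obj j))) :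
    Continuous fun p : unitInterval × ClassifyingSpace Δ M =>
      ClassifyingSpace.map ρ a (b p.1) p.2 := by
  refine Realization.continuous_map_family (Δ := simplexProd Δ) (X := degreewiseBar M)
    (Δ' := simplexProd Δ') (Y := degreewiseBar N) (Functor.prod (𝟭 SimplexCategory) ρ) _
    (fun s =>
      { app := fun x => TopCat.ofHom ((ContinuousMap.id _).prodMap ((b s).app x.2).hom)
        naturality := fun x x' f => by
          ext y
          apply Prod.ext
          · rfl
          · exact ConcreteCategory.congr_hom ((b s).naturality f.2) y.2 }) ?_
  rintro ⟨p, j⟩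
  change Continuous fun y : unitInterval × (SimplexCategory.toTop₀.obj p × Δ.obj j) =>
    (y.2.1, ((b y.1).app j y.2.2 : Δ'.obj (ρ.obj j)))
  exact (continuous_fst.comp continuous_snd).prodMk
    ((hb j).comp (continuous_fst.prodMk (continuous_snd.comp continuous_snd)))

end ClassifyingSpaceHomotopy

/-! ### The flip of the ordinary bar construction -/

section Flip

variable (R : Type u) [Ring R]

/-- The self-map of `B(∐ₙ |BGLₙ(R)|)` given on the realisation of `BGLₙ(R)` by
`[x, t] ↦ [double x, ((1 - s) t, s t)]`. -/
noncomputable def doublingBM (s : unitInterval) : C(RingBM R, RingBM R) :=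
  ClassifyingSpace.map doubling (glBarDouble R) (simplexDouble s)

lemma doublingBM_base (s : unitInterval) : doublingBM R s (ringBase R) = ringBase R := by
  refine (ClassifyingSpace.map_base _ _ _ _ _).trans ?_
  refine (ClassifyingSpace.base_eq (SimplexCategory.isTerminalZero.from _) _).trans ?_
  exact congrArg (ClassifyingSpace.base simplexTop (glBar R) (SimplexCategory.mk 0))
    (Subsingleton.elim (α := SimplexCategory.toTop₀.obj (SimplexCategory.mk 0)) _ _)

lemma doublingBM_zero : doublingBM R 0 = ContinuousMap.id (RingBM R) := by
  ext z
  obtain ⟨p, q, x, w, t, rfl⟩ := ClassifyingSpace.mk_surjective z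
  refine (ClassifyingSpace.map_mk _ _ _ _ _ _ _ _).trans ?_
  -- At `s = 0` the point lies on the front face of the doubled simplex.
  have ht : (simplexDouble 0).app q t = simplexTop.map (lowerHom q) t := doublePoint_zero _
  rw [ht]
  refine (ClassifyingSpace.mk_map (M := glBar R) p (lowerHom q) _ w t).symm.trans ?_
  refine congrArg (fun x => Realization.mk (simplexProd simplexTop) (degreewiseBar (glBar R))
    (p, q) x (w, t)) ?_
  apply MonoidBar.ext
  funext i j h
  exact congrArg (Sigma.mk (x.a i j h).1) (MonoidBar.double_pull_lower (x.a i j h).2)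

/-- The flip `doublingBM R 1` is homotopic to the identity relative to the base point. -/
lemma doublingBM_homotopicRel :
    (ContinuousMap.id (RingBM R)).HomotopicRel (doublingBM R 1) {ringBase R} := by
  refine ⟨⟨⟨⟨fun p => doublingBM R p.1 p.2, ?_⟩, ?_, ?_⟩, ?_⟩⟩
  · exact ClassifyingSpace.continuous_map_family doubling (glBarDouble R) simplexDouble
      fun q => continuous_doublePoint
  · intro z
    exact congrArg (fun f : C(RingBM R, RingBM R) => f z) (doublingBM_zero R)
  · intro z
    rfl
  · rintro s _ rfl
    exact doublingBM_base R s

/-- Up to the comparison map, `τ` is the composite of the classical involution and the flip: both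
sides send a simplex with entries `a i j` to the one with entries `(a (q - j) (q - i))ᴴ`. -/
lemma tauBM_comparisonBM [StarRing R] (z : RingBM R) :
    tauBM R (comparisonBM R z) = comparisonBM R (doublingBM R 1 (classicalInvBM R z)) := by
  obtain ⟨p, q, x, w, t, rfl⟩ := ClassifyingSpace.mk_surjective z
  -- At `s = 1` the point lies on the back face, whose vertices are those of `[q]` in reversed order.
  have ht : (simplexDouble 1).app q t =
      simplexTop.map (upperHom q) ((simplexFlip.app q) t) := by
    refine (doublePoint_one _).trans ((congrArg (fun f => stdSimplex.map f _) ?_).trans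
      (stdSimplex.map_comp_apply (Fin.rev : Fin (q.len + 1) → Fin (q.len + 1))
        (upperHom q).toOrderHom _).symm)
    funext i
    exact (congrArg upper (Fin.rev_rev i)).symm
  have h : doublingBM R 1 (classicalInvBM R (Realization.mk (simplexProd simplexTop)
      (degreewiseBar (glBar R)) (p, q) x (w, t))) =
      Realization.mk (simplexProd simplexTop) (degreewiseBar (glBar R)) (p, q)
        (MonoidBar.map ((glBar R).map (upperHom q).op).hom
          (MonoidBar.map ((glBarDouble R).app (op q)).hom
            (MonoidBar.map ((glBarInv R).app (op q)).hom x))) (w, (simplexFlip.app q) t) := by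
    refine Eq.trans ?_ (ClassifyingSpace.mk_map (M := glBar R) p (upperHom q) _ w _).symm
    rw [← ht]
    rfl
  rw [h]
  refine congrArg (fun x => Realization.mk (simplexProd biSimplexTop) (degreewiseBar (catBar R))
    (p, (q, SimplexCategory.mk 0)) x (w, ((simplexFlip.app q) t, default))) ?_
  apply MonoidBar.ext
  funext i j h
  refine CatBar.ext fun r k l hkl => ?_
  refine congrArg (Sigma.mk (x.a i j h).1) ?_
  refine (congrArg Units.val (MonoidBar.double_pull_upper_a
    ((x.a i j h).2.map (conjTransposeInv R (x.a i j h).1)) hkl)).symm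

end Flip

/-! ### The comparison map is a homeomorphism -/

section Homeomorphism

variable {R : Type u} [Ring R]

/-- Morphisms in `B_q GLₙ(𝓡_R)` are identities, so that the simplices in the nerve direction are
constant. -/
lemma CatBar.entry_eq {q s : SimplexCategory} (x : CatBar R q s) (t t' : Fin (s.len + 1))
    (i j : Fin (q.len + 1)) (h : i ≤ j) : x.entry t i j h = x.entry t' i j h := by
  have key : ∀ {t t' : Fin (s.len + 1)}, t ≤ t' → x.entry t i j h = x.entry t' i j h := by
    intro t t' ht
    exact congrArg (fun A => (⟨x.1, MatCat.toMatrix A⟩ : SqMat R))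
      (MatCat.eq_of_hom ((x.chain.map (homOfLE ht)).f i j h).hom)
  exact (key (Fin.zero_le t)).symm.trans (key (Fin.zero_le t'))

/-- The simplex of `∐ₙ BGLₙ(R)` underlying a simplex of `∐ₙ N(BGLₙ(𝓡_R))`, formed by the first
object of the chain. -/
noncomputable def CatBar.toGLBar {q s : SimplexCategory} (x : CatBar R q s) : GLBar R q :=
  ⟨x.1,
    { a := fun i j h => ((x.chain.obj 0).obj i j h).property.unit
      a_self := fun i => Units.ext (by
        change ((x.chain.obj 0).obj i i le_rfl).obj.toMatrix = 1
        rw [(x.chain.obj 0).obj_self, GLCat.toMatrix_unit])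
      a_mul := fun i j k hij hjk => Units.ext ((GLCat.toMatrix_tensor _ _).symm.trans
        (congrArg MatCat.toMatrix
          (MatCat.eq_of_hom ((x.chain.obj 0).φ i j k hij hjk).hom.hom))) }⟩

/-- Forgetting the nerve direction, as a map of multisimplicial monoids. -/
noncomputable def nerveCollapse (R : Type u) [Ring R] :
    catBar R ⟶ (CategoryTheory.Prod.fst SimplexCategory SimplexCategory).op ⋙ glBar R where
  app x := MonCat.ofHom (X := CatBar R x.unop.1 x.unop.2) (Y := GLBar R x.unop.1)
    { toFun := CatBar.toGLBar
      map_one' := GLBar.ext fun _ _ _ => congrArg (Sigma.mk 0) (Subsingleton.elim _ _)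
      map_mul' := fun _ _ => GLBar.ext fun _ _ _ => rfl }
  naturality x y f := by
    ext z
    exact GLBar.ext fun i j h => CatBar.entry_eq (R := R) z _ _ _ _ _

/-- The map `B(∐ₙ |BGLₙ(𝓡_R)|) → B(∐ₙ |BGLₙ(R)|)` forgetting the nerve direction. -/
noncomputable def collapseBM (R : Type u) [Ring R] : C(BimonBM R, RingBM R) :=
  ClassifyingSpace.map (CategoryTheory.Prod.fst SimplexCategory SimplexCategory)
    (nerveCollapse R)
    { app := fun x => TopCat.ofHom (X := SimplexCategory.toTop₀.obj x.1 ×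
        SimplexCategory.toTop₀.obj x.2) ContinuousMap.fst
      naturality := fun _ _ _ => rfl }

lemma collapseBM_comparisonBM (R : Type u) [Ring R] :
    (collapseBM R).comp (comparisonBM R) = ContinuousMap.id (RingBM R) := by
  ext z
  obtain ⟨p, q, x, w, t, rfl⟩ := ClassifyingSpace.mk_surjective z
  refine congrArg (fun x => Realization.mk (simplexProd simplexTop) (degreewiseBar (glBar R))
    (p, q) x (w, t)) ?_
  apply MonoidBar.ext
  funext i j h
  exact GLBar.ext fun _ _ _ => rfl

lemma comparisonBM_collapseBM (R : Type u) [Ring R] :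
    (comparisonBM R).comp (collapseBM R) = ContinuousMap.id (BimonBM R) := by
  ext z
  obtain ⟨p, ⟨q, s⟩, x, w, ⟨t, r⟩, rfl⟩ := ClassifyingSpace.mk_surjective z
  let f : ((q, s) : SimplexCategory × SimplexCategory) ⟶ (q, SimplexCategory.mk 0) :=
    (𝟙 q, SimplexCategory.isTerminalZero.from s)
  let y : MonoidBar (CatBar R q (SimplexCategory.mk 0)) p :=
    MonoidBar.map ((barComparison R).app (op q)).hom
      (MonoidBar.map ((nerveCollapse R).app (op (q, s))).hom x)
  have ht : biSimplexTop.map f (t, r) = (t, default) := by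
    refine Prod.ext ?_ ?_
    · exact ConcreteCategory.congr_hom (SimplexCategory.toTop₀.map_id q) t
    · exact Subsingleton.elim (α := SimplexCategory.toTop₀.obj (SimplexCategory.mk 0)) _ _
  have hx : y.map ((catBar R).map f.op).hom = x := by
    apply MonoidBar.ext
    funext i j h
    exact CatBar.ext fun _ _ _ _ => CatBar.entry_eq (x.a i j h) 0 _ _ _ _
  have h := ClassifyingSpace.mk_map (Δ := biSimplexTop) (M := catBar R) p f y w (t, r)
  rw [hx, ht] at h
  exact h.symm

lemma collapseBM_base (R : Type u) [Ring R] : collapseBM R (bimonBase R) = ringBase R := by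
  rw [← comparisonBM_base, ← ContinuousMap.comp_apply, collapseBM_comparisonBM,
    ContinuousMap.id_apply]

end Homeomorphism

/-! ### The comparison isomorphism -/

/-- The comparison map as an isomorphism of groups. -/
noncomputable def comparisonEquiv (R : Type u) [Ring R] (i : ℕ) [NeZero i] :
    RingK R i ≃* BimonK R i where
  toFun := comparisonK R i
  invFun := loopHomotopyGroupMap (Fin i) (collapseBM R) (collapseBM_base R)
  left_inv z :=
    (loopHomotopyGroupMap_comp (Fin i) (comparisonBM R) (collapseBM R) (comparisonBM_base R)
      (collapseBM_base R) (by rw [collapseBM_comparisonBM, ContinuousMap.id_apply]) z).trans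
      (loopHomotopyGroupMap_id _ (collapseBM_comparisonBM R) _ z)
  right_inv z :=
    (loopHomotopyGroupMap_comp (Fin i) (collapseBM R) (comparisonBM R) (collapseBM_base R)
      (comparisonBM_base R) (by rw [comparisonBM_collapseBM, ContinuousMap.id_apply]) z).trans
      (loopHomotopyGroupMap_id _ (comparisonBM_collapseBM R) _ z)
  map_mul' := homotopyGroupMap_mul (Fin i) _ _

lemma comparisonK_classicalInv (R : Type u) [Ring R] [StarRing R] (i : ℕ) (x : RingK R i) :
    comparisonK R i (classicalInv R i x) = tauK R i (comparisonK R i x) := by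
  have h₁ : ((comparisonBM R).comp (classicalInvBM R)) (ringBase R) = bimonBase R := by
    rw [ContinuousMap.comp_apply, classicalInvBM_base, comparisonBM_base]
  have h₂ : ((tauBM R).comp (comparisonBM R)) (ringBase R) = bimonBase R := by
    rw [ContinuousMap.comp_apply, comparisonBM_base, tauBM_base]
  have H : ((comparisonBM R).comp (classicalInvBM R)).HomotopicRel
      ((tauBM R).comp (comparisonBM R)) {ringBase R} := by
    obtain ⟨H⟩ := doublingBM_homotopicRel R
    refine ⟨⟨⟨(comparisonBM R).comp (H.toContinuousMap.comp
      ((ContinuousMap.id unitInterval).prodMap (classicalInvBM R))), fun z => ?_, fun z => ?_⟩, ?_⟩⟩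
    · exact congrArg (comparisonBM R) (H.apply_zero (classicalInvBM R z))
    · exact (congrArg (comparisonBM R) (H.apply_one (classicalInvBM R z))).trans
        (tauBM_comparisonBM R z).symm
    · rintro s _ rfl
      refine congrArg (comparisonBM R) (H.eq_fst s ?_)
      exact classicalInvBM_base R
  exact (loopHomotopyGroupMap_comp (Fin i) (classicalInvBM R) (comparisonBM R)
    (classicalInvBM_base R) (comparisonBM_base R) h₁ x).trans
    ((congrFun (loopHomotopyGroupMap_congr (Fin i) h₁ h₂ H) x).trans
    (loopHomotopyGroupMap_comp (Fin i) (comparisonBM R) (tauBM R)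
      (comparisonBM_base R) (tauBM_base R) h₂ x).symm)

end BimonoidalK

theorem mainTheorem2 (R : Type u) [Ring R] [StarRing R] (i : ℕ) [NeZero i] :
    ∃ e : BimonoidalK.RingK R i ≃* BimonoidalK.BimonK R i,
      (∀ x, e x = BimonoidalK.comparisonK R i x) ∧
      ∀ x, e (BimonoidalK.classicalInv R i x) = BimonoidalK.tauK R i (e x) :=
  ⟨BimonoidalK.comparisonEquiv R i, fun _ => rfl, BimonoidalK.comparisonK_classicalInv R i⟩
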